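/- Let $H,U$ be real Hilbert spaces, $0<\alpha\le 1$, $b>0$, $0=t_0<t_1<\dots<t_n\le t_{n+1}=b$ ($n\ge 0$). Let $A$ be the generator of a $C_0$-semigroup $(S(t))_{t\ge 0}$ on $H$, and let $B\in\mathcal L(U,H)$, $D_k\in\mathcal L(H)$, $E_k\in\mathcal L(U,H)$ for $k=1,\dots,n$. Consider the fractional impulsive control system on $[0,b]$ $$ {}^{C}D^{\alpha}_{t_k^+}x(t)=Ax(t)+Bu(t)\ \ (t\ne t_1,\dots,t_n),\qquad x(t_k^+)-x(t_k)=D_kx(t_k)+E_kv_k\ \ (1\le k\le n),\qquad x(0)=x_0,$$ with controls $(u,(v_k)_{k=1}^n)$ in the Hilbert space $X=L^2([0,b],U)\times U^n$ with the inner product $\int_0^b\langle u_1,u_2\rangle\,ds+\sum_{k}\langle v_{1k},v_{2k}\rangle$. For $0<\alpha<1$ put, for $t\ge 0$ and $x\in H$, $$\mathcal S_\alpha(t)x=\int_0^\infty\Psi_\alpha(\theta)S(t^\alpha\theta)x\,d\theta,\qquad \mathcal P_\alpha(t)x=\int_0^\infty\alpha\theta\,\Psi_\alpha(\theta)S(t^\alpha\theta)x\,d\theta,\qquad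 \Psi_\alpha(\theta)=\sum_{m=0}^\infty\frac{(-\theta)^m}{m!\,\Gamma(-\alpha m+1-\alpha)},$$ and put $\mathcal S_1=\mathcal P_1=S$. For $1\le i\le n+1$ let $$W_i=\mathcal S_\alpha(b-t_n)\,(I+D_n)\mathcal S_\alpha(t_n-t_{n-1})\cdots(I+D_i)\mathcal S_\alpha(t_i-t_{i-1}),\qquad W_{n+1}=\mathcal S_\alpha(b-t_n).$$ Define the controllability map (the value at time $b$ of the mild solution with $x_0=0$) $$\mathcal M(u,(v_k))=\int_{t_n}^b(b-s)^{\alpha-1}\mathcal P_\alpha(b-s)Bu(s)\,ds+\sum_{i=1}^nW_{i+1}(I+D_i)\int_{t_{i-1}}^{t_i}(t_i-s)^{\alpha-1}\mathcal P_\alpha(t_i-s)Bu(s)\,ds+\sum_{k=1}^nW_{k+1}E_kv_k$$ and, with $G_{a}^{c}=\int_a^c(c-s)^{2\alpha-2}\mathcal P_\alpha(c-s)BB^*\mathcal P_\alpha^*(c-s)\,ds$ in the strong sense, the operators $$\Omega=G_{t_n}^b,\quad \Psi=\sum_{i=1}^nW_{i+1}(I+D_i)\,G_{t_{i-1}}^{t_i}\,(I+D_i)^*W_{i+1}^*,\quad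 \tilde\Omega=\mathcal S_\alpha(b-t_n)E_nE_n^*\mathcal S_\alpha^*(b-t_n),\quad \tilde\Psi=\sum_{i=2}^nW_iE_{i-1}E_{i-1}^*W_i^*$$ ($\tilde\Omega=0$ if $n=0$) and $\mathcal G=\Omega+\Psi+\tilde\Omega+\tilde\Psi$. The system is called approximately controllable on $[0,b]$ if the image of $\mathcal M$ is dense in $H$. Assume that $\alpha>\tfrac12$ or $B=0$ (this is exactly the case in which $\mathcal M$ is defined on all of $X$). Then all the series and integrals above converge, $\mathcal M:X\to H$ is a bounded linear operator, $\mathcal M\mathcal M^*=\mathcal G$, the operator $\varepsilon I+\mathcal G$ is invertible in $\mathcal L(H)$ for every $\varepsilon>0$, and the following five conditions are equivalent: (i) the system is approximately controllable on $[0,b]$; (ii) $\mathcal M^*\varphi=0$ implies $\varphi=0$; (iii) $\mathcal G$ is strictly positive, that is, $\langle\mathcal G\varphi,\varphi\rangle>0$ for every $\varphi\ne 0$; (iv) $\varepsilon(\varepsilon I+\mathcal G)^{-1}\to 0$ as $\varepsilon\to 0^+$ in the strong operator topology; (v) $\varepsilon(\varepsilon I+\mathcal G)^{-1}\to 0$ as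 $\varepsilon\to 0^+$ in the weak operator topology. -/

import Mathlib

open MeasureTheory Filter Topology

/-- The `n`-th term `(-θ)ⁿ / (n! Γ(-α n + 1 - α))` of the Wright series.
Mathlib's `Real.Gamma` vanishes at its poles, so a term with a pole of `Γ` in the denominator
is `0`, as it is for the reciprocal Gamma function. -/
noncomputable def wrightTerm (α θ : ℝ) (n : ℕ) : ℝ :=
  (-θ) ^ n / ((n.factorial : ℝ) * Real.Gamma (-α * n + 1 - α))

/-- The Wright function `Ψ_α(θ) = ∑ (-θ)ⁿ / (n! Γ(-α n + 1 - α))`, for `0 < α < 1`. -/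
noncomputable def wright (α θ : ℝ) : ℝ := ∑' n : ℕ, wrightTerm α θ n

section StrongIntegral

variable {Θ H : Type*} [MeasurableSpace Θ] [NormedAddCommGroup H] [InnerProductSpace ℝ H]

/-- The family `F` of bounded operators is integrable in the strong sense: each orbit
`θ ↦ F θ x` is Bochner integrable. -/
def StronglyIntegrable (μ : Measure Θ) (F : Θ → H →L[ℝ] H) : Prop :=
  ∀ x, Integrable (fun θ => F θ x) μ

/-- For a strongly integrable family, `x ↦ (θ ↦ F θ x)` as a linear map into `L¹`. -/
noncomputable def orbitL1 (μ : Measure Θ) (F : Θ → H →L[ℝ] H)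
    (hF : StronglyIntegrable μ F) : H →ₗ[ℝ] Lp H 1 μ where
  toFun x := (hF x).toL1 (fun θ => F θ x)
  map_add' x y := by
    rw [← Integrable.toL1_add]
    congr 1
    ext θ
    simp
  map_smul' c x := by
    rw [RingHom.id_apply, ← Integrable.toL1_smul]
    congr 1
    ext θ
    simp

theorem orbitL1_closed [CompleteSpace H] (μ : Measure Θ) (F : Θ → H →L[ℝ] H)
    (hF : StronglyIntegrable μ F) :
    ∀ (u : ℕ → H) (x : H) (y : Lp H 1 μ), Tendsto u atTop (𝓝 x) →
      Tendsto (orbitL1 μ F hF ∘ u) atTop (𝓝 y) → y = orbitL1 μ F hF x := by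
  intro u x y hu hy
  obtain ⟨ns, hns, hae⟩ := (tendstoInMeasure_of_tendsto_Lp hy).exists_seq_tendsto_ae
  have hall : ∀ᵐ θ ∂μ, ∀ n, (orbitL1 μ F hF (u n)) θ = F θ (u n) :=
    ae_all_iff.2 fun n => (hF (u n)).coeFn_toL1
  have hx : ∀ᵐ θ ∂μ, (orbitL1 μ F hF x) θ = F θ x := (hF x).coeFn_toL1
  apply Lp.ext
  filter_upwards [hae, hall, hx] with θ h1 h2 h3
  rw [h3]
  refine tendsto_nhds_unique h1 ?_
  have h4 : (fun i => ((orbitL1 μ F hF ∘ u) (ns i) : Lp H 1 μ) θ) = fun i => F θ (u (ns i)) := by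
    funext i
    exact h2 (ns i)
  rw [h4]
  exact ((F θ).continuous.tendsto x).comp (hu.comp hns.tendsto_atTop)

open Classical in
/-- The strong operator integral `x ↦ ∫ F θ x dμ(θ)` of a strongly integrable family of bounded
operators, as a bounded operator (it is bounded by the closed graph theorem).
It has the value `0` for families that are not strongly integrable. -/
noncomputable def strongIntegral [CompleteSpace H] (μ : Measure Θ) (F : Θ → H →L[ℝ] H) :
    H →L[ℝ] H :=
  if hF : StronglyIntegrable μ F then
    (L1.integralCLM' (α := Θ) (E := H) (μ := μ) ℝ).comp
      (ContinuousLinearMap.ofSeqClosedGraph (orbitL1_closed μ F hF))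
  else 0

theorem strongIntegral_apply [CompleteSpace H] (μ : Measure Θ) (F : Θ → H →L[ℝ] H)
    (hF : StronglyIntegrable μ F) (x : H) : strongIntegral μ F x = ∫ θ, F θ x ∂μ := by
  have h1 : strongIntegral μ F x = L1.integral ((hF x).toL1 (fun θ => F θ x)) := by
    rw [strongIntegral, dif_pos hF, L1.integral_eq]
    rfl
  rw [h1, L1.integral_eq_integral]
  exact integral_congr_ae (hF x).coeFn_toL1

end StrongIntegral

section System

variable (H U : Type*) [NormedAddCommGroup H] [InnerProductSpace ℝ H] [CompleteSpace H]
  [NormedAddCommGroup U] [InnerProductSpace ℝ U] [CompleteSpace U]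

/-- A strongly continuous semigroup of bounded operators; only times `t ≥ 0` matter. -/
structure C0Semigroup where
  /-- the operators `S(t)` -/
  op : ℝ → H →L[ℝ] H
  op_zero : op 0 = 1
  op_mul : ∀ s t, 0 ≤ s → 0 ≤ t → op s * op t = op (s + t)
  tendsto_zero : ∀ x, Tendsto (fun t => op t x) (𝓝[>] 0) (𝓝 x)

variable {H}

/-- `A` is the infinitesimal generator of `S`: the domain of `A` is the set of all `x` for which
`lim_{t → 0+} (S(t) x - x) / t` exists, and `A x` is that limit. -/
def C0Semigroup.IsGenerator (S : C0Semigroup H) (A : H →ₗ.[ℝ] H) : Prop :=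
  ∀ x y, (x, y) ∈ A.graph ↔ Tendsto (fun t : ℝ => t⁻¹ • (S.op t x - x)) (𝓝[>] 0) (𝓝 y)

/-- The integrand `Ψ_α(θ) S(t^α θ)`. -/
noncomputable def fracSKernel (α : ℝ) (S : C0Semigroup H) (t θ : ℝ) : H →L[ℝ] H :=
  wright α θ • S.op (t ^ α * θ)

/-- The integrand `α θ Ψ_α(θ) S(t^α θ)`. -/
noncomputable def fracPKernel (α : ℝ) (S : C0Semigroup H) (t θ : ℝ) : H →L[ℝ] H :=
  (α * θ * wright α θ) • S.op (t ^ α * θ)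

open Classical in
/-- `𝒮_α(t) x = ∫_0^∞ Ψ_α(θ) S(t^α θ) x dθ` for `0 < α < 1`. For `α = 1` the measure
`Ψ_α(θ) dθ` degenerates to the unit mass at `θ = 1` and `𝒮_1 = S`. -/
noncomputable def fracS (α : ℝ) (S : C0Semigroup H) (t : ℝ) : H →L[ℝ] H :=
  if α = 1 then S.op t else strongIntegral (volume.restrict (Set.Ioi 0)) (fracSKernel α S t)

open Classical in
/-- `𝒫_α(t) x = ∫_0^∞ α θ Ψ_α(θ) S(t^α θ) x dθ` for `0 < α < 1`, and `𝒫_1 = S`. -/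
noncomputable def fracP (α : ℝ) (S : C0Semigroup H) (t : ℝ) : H →L[ℝ] H :=
  if α = 1 then S.op t else strongIntegral (volume.restrict (Set.Ioi 0)) (fracPKernel α S t)

variable (H)

/-- The data of the linear fractional impulsive control system
`ᶜD^α x = A x + B u` off the impulse times `t_1, …, t_n`, with jumps
`x(t_k⁺) - x(t_k) = D_k x(t_k) + E_k v_k`, on `[0, b]`.
In the sequences `t`, `D`, `E` only the indices `1, …, n` matter, and `t_0 = 0`. -/
structure FracImpulsiveSystem where
  /-- the order of the Caputo derivative -/
  α : ℝ
  α_pos : 0 < α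
  α_le_one : α ≤ 1
  /-- the operator acting on the state -/
  A : H →ₗ.[ℝ] H
  /-- the semigroup generated by `A` -/
  S : C0Semigroup H
  generates : S.IsGenerator A
  /-- the operator of the distributed control -/
  B : U →L[ℝ] H
  /-- the final time -/
  b : ℝ
  b_pos : 0 < b
  /-- the number of impulses -/
  n : ℕ
  /-- the impulse times -/
  t : ℕ → ℝ
  t_zero : t 0 = 0
  t_strictMonoOn : StrictMonoOn t (Set.Iic n)
  t_le : t n ≤ b
  /-- the impulse operators on the state -/
  D : ℕ → H →L[ℝ] H
  /-- the operators of the impulsive controls -/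
  E : ℕ → U →L[ℝ] H

variable {H U}

namespace FracImpulsiveSystem

variable (sys : FracImpulsiveSystem H U)

/-- The Hilbert space `L²([0,b], U) × Uⁿ` of controls `(u, (v_k)_{1 ≤ k ≤ n})` with inner product
`∫_0^b ⟪u₁, u₂⟫ + ∑ ⟪v₁ₖ, v₂ₖ⟫`. -/
abbrev Controls : Type _ :=
  WithLp 2 (Lp U 2 (volume.restrict (Set.Icc 0 sys.b)) ×
    PiLp 2 (fun _ : Finset.Icc 1 sys.n => U))

/-- `(I + D_j) 𝒮_α(t_j - t_{j-1})`. -/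
noncomputable def jumpStep (j : ℕ) : H →L[ℝ] H :=
  (1 + sys.D j) * fracS sys.α sys.S (sys.t j - sys.t (j - 1))

/-- `𝒮_α(b - t_n) ∏_{j=n}^{i} (I + D_j) 𝒮_α(t_j - t_{j-1})`, the factors with larger `j` standing
to the left; the product is empty for `i = n + 1`. -/
noncomputable def propagator (i : ℕ) : H →L[ℝ] H :=
  fracS sys.α sys.S (sys.b - sys.t sys.n) *
    ((List.range' i (sys.n + 1 - i)).reverse.map sys.jumpStep).prod

/-- The integrand `s ↦ (c - s)^{α-1} 𝒫_α(c - s) B u(s)`. -/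
noncomputable def segIntegrand (c : ℝ) (u : ℝ → U) (s : ℝ) : H :=
  (c - s) ^ (sys.α - 1) • fracP sys.α sys.S (c - s) (sys.B (u s))

/-- `∫_a^c (c - s)^{α-1} 𝒫_α(c - s) B u(s) ds`. -/
noncomputable def segMap (a c : ℝ) (u : ℝ → U) : H :=
  ∫ s in Set.Ioc a c, sys.segIntegrand c u s

/-- The controllability map: the value at time `b` of the mild solution with `x(0) = 0`,
`∫_{t_n}^b (b-s)^{α-1} 𝒫_α(b-s) B u(s) ds
  + 𝒮_α(b-t_n) ∑_{i=1}^n ∏_{j=n}^{i+1} (I+D_j) 𝒮_α(t_j-t_{j-1}) (I+D_i)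
      ∫_{t_{i-1}}^{t_i} (t_i-s)^{α-1} 𝒫_α(t_i-s) B u(s) ds
  + 𝒮_α(b-t_n) ∑_{k=1}^n ∏_{j=n}^{k+1} (I+D_j) 𝒮_α(t_j-t_{j-1}) E_k v_k`. -/
noncomputable def controlMap (w : sys.Controls) : H :=
  sys.segMap (sys.t sys.n) sys.b w.fst
    + ∑ i ∈ Finset.Icc 1 sys.n,
        sys.propagator (i + 1) ((1 + sys.D i) (sys.segMap (sys.t (i - 1)) (sys.t i) w.fst))
    + ∑ k : Finset.Icc 1 sys.n, sys.propagator (k + 1) (sys.E k (w.snd k))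

/-- Approximate controllability on `[0, b]`: the image of the controllability map is dense. -/
def IsApproxControllable : Prop := closure (Set.range sys.controlMap) = Set.univ

/-- The integrand `s ↦ (c - s)^{2α-2} 𝒫_α(c - s) B B* 𝒫_α*(c - s)`. -/
noncomputable def gramKernel (c s : ℝ) : H →L[ℝ] H :=
  (c - s) ^ (2 * sys.α - 2) •
    (fracP sys.α sys.S (c - s) ∘L sys.B ∘L ContinuousLinearMap.adjoint sys.B ∘L
      ContinuousLinearMap.adjoint (fracP sys.α sys.S (c - s)))

/-- `∫_a^c (c - s)^{2α-2} 𝒫_α(c - s) B B* 𝒫_α*(c - s) ds`, a strong operator integral. -/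
noncomputable def segGram (a c : ℝ) : H →L[ℝ] H :=
  strongIntegral (volume.restrict (Set.Ioc a c)) (sys.gramKernel c)

/-- `Ω = ∫_{t_n}^b (b-s)^{2α-2} 𝒫_α(b-s) B B* 𝒫_α*(b-s) ds`. -/
noncomputable def gramΩ : H →L[ℝ] H := sys.segGram (sys.t sys.n) sys.b

/-- `Ψ`: with `K_i = 𝒮_α(b-t_n) ∏_{j=n}^{i+1} (I+D_j) 𝒮_α(t_j-t_{j-1}) (I+D_i)`, the sum over
`i = 1, …, n` of `K_i ∫_{t_{i-1}}^{t_i} (t_i-s)^{2α-2} 𝒫_α(t_i-s) B B* 𝒫_α*(t_i-s) ds K_i*`. -/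
noncomputable def gramΨ : H →L[ℝ] H :=
  ∑ i ∈ Finset.Icc 1 sys.n,
    (sys.propagator (i + 1) * (1 + sys.D i)) * sys.segGram (sys.t (i - 1)) (sys.t i) *
      ContinuousLinearMap.adjoint (sys.propagator (i + 1) * (1 + sys.D i))

/-- `Ω̃ = 𝒮_α(b-t_n) E_n E_n* 𝒮_α*(b-t_n)` (absent when there is no impulse). -/
noncomputable def gramΩt : H →L[ℝ] H :=
  if sys.n = 0 then 0 else
    fracS sys.α sys.S (sys.b - sys.t sys.n) ∘L sys.E sys.n ∘L
      ContinuousLinearMap.adjoint (sys.E sys.n) ∘L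
      ContinuousLinearMap.adjoint (fracS sys.α sys.S (sys.b - sys.t sys.n))

/-- `Ψ̃`: with `L_i = 𝒮_α(b-t_n) ∏_{j=n}^{i} (I+D_j) 𝒮_α(t_j-t_{j-1})`, the sum over
`i = 2, …, n` of `L_i E_{i-1} E_{i-1}* L_i*`. -/
noncomputable def gramΨt : H →L[ℝ] H :=
  ∑ i ∈ Finset.Icc 2 sys.n,
    sys.propagator i ∘L sys.E (i - 1) ∘L ContinuousLinearMap.adjoint (sys.E (i - 1)) ∘L
      ContinuousLinearMap.adjoint (sys.propagator i)

/-- The controllability Gramian `Ω + Ψ + Ω̃ + Ψ̃`. -/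
noncomputable def gramian : H →L[ℝ] H := sys.gramΩ + sys.gramΨ + sys.gramΩt + sys.gramΨt

/-- The impulsive resolvent operator `ε (ε I + Ω + Ψ + Ω̃ + Ψ̃)⁻¹`. -/
noncomputable def resolvent (ε : ℝ) : H →L[ℝ] H :=
  ε • Ring.inverse (ε • (1 : H →L[ℝ] H) + sys.gramian)

/-- All the series and integrals that enter the definitions of `𝒮_α`, `𝒫_α`, the controllability
map and the Gramian converge. -/
structure Converges : Prop where
  wright : sys.α < 1 → ∀ θ : ℝ, Summable (wrightTerm sys.α θ)
  fracS : sys.α < 1 → ∀ t : ℝ, 0 ≤ t →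
    StronglyIntegrable (volume.restrict (Set.Ioi 0)) (fracSKernel sys.α sys.S t)
  fracP : sys.α < 1 → ∀ t : ℝ, 0 ≤ t →
    StronglyIntegrable (volume.restrict (Set.Ioi 0)) (fracPKernel sys.α sys.S t)
  seg : ∀ u : Lp U 2 (volume.restrict (Set.Icc 0 sys.b)), ∀ i ∈ Finset.Icc 1 sys.n,
    IntegrableOn (sys.segIntegrand (sys.t i) u) (Set.Ioc (sys.t (i - 1)) (sys.t i))
  seg_last : ∀ u : Lp U 2 (volume.restrict (Set.Icc 0 sys.b)),
    IntegrableOn (sys.segIntegrand sys.b u) (Set.Ioc (sys.t sys.n) sys.b)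
  gram : ∀ i ∈ Finset.Icc 1 sys.n,
    StronglyIntegrable (volume.restrict (Set.Ioc (sys.t (i - 1)) (sys.t i)))
      (sys.gramKernel (sys.t i))
  gram_last : StronglyIntegrable (volume.restrict (Set.Ioc (sys.t sys.n) sys.b))
    (sys.gramKernel sys.b)

end FracImpulsiveSystem

end System

/-- A bounded operator is strictly positive if `⟪T y, y⟫ > 0` for every non-zero `y`. -/
def IsStrictlyPos {H : Type*} [NormedAddCommGroup H] [InnerProductSpace ℝ H]
    (T : H →L[ℝ] H) : Prop :=
  ∀ y : H, y ≠ 0 → 0 < inner ℝ (T y) y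

/-! The five equivalences are Hilbert space theory resting on the single identity `M M* = G`. It
gives `⟪G x, x⟫ = ‖M* x‖²`, so `ε I + G` is coercive, hence invertible, and `R_ε = ε (ε I + G)⁻¹` is
a contraction. Density of the range of `M` is injectivity of `M*`, which is strict positivity of
`G`. If the self-adjoint `G` is injective, its range is dense; on that range `R_ε G z = ε z - ε R_ε
z → 0`, and contractivity carries this to all of `H`. Conversely `M* φ = 0` forces `R_ε φ = φ`, so
even weak convergence to `0` gives `φ = 0` (`tfae_gram`).

To obtain the identity, the adjoint of the distributed part is built first, as a sum of operators
into `L²`, each supported on one interval between impulses. Disjoint supports kill the cross terms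
of `T* T`, leaving one Gramian per interval (`distributed_gram`). The impulsive controls are
independent coordinates and add their own squares (`exists_productOp`, `sum_impulse_gram`).

The analytic work is to make these operators exist. The semigroup grows at most exponentially, and
the Wright function decays faster than any exponential (`wright_decay`), so `𝒮_α` and `𝒫_α` converge
strongly and `𝒫_α` is strongly continuous. The decay comes from a real integral for the Wright
function, obtained from Euler's integral and the reflection formula, followed by a contour shift.
Finally `(c - s)^(α-1)` is square integrable because `α > 1/2`; if `B = 0` the kernel vanishes. -/

/-! ### Growth and strong continuity of semigroups -/

namespace C0Semigroup

variable {H : Type*} [NormedAddCommGroup H] [InnerProductSpace ℝ H] [CompleteSpace H]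
  (S : C0Semigroup H)

theorem tendsto_nhdsGE_zero (x : H) : Tendsto (fun t => S.op t x) (𝓝[≥] 0) (𝓝 x) := by
  have h : Set.Ici (0 : ℝ) = insert 0 (Set.Ioi 0) := by
    ext t; simp [le_iff_eq_or_lt, eq_comm]
  rw [h, nhdsWithin_insert, tendsto_sup]
  refine ⟨?_, S.tendsto_zero x⟩
  have : S.op 0 x = x := by rw [S.op_zero]; rfl
  rw [tendsto_pure_left]
  intro s hs
  rw [this]
  exact mem_of_mem_nhds hs

theorem op_add_apply {s t : ℝ} (hs : 0 ≤ s) (ht : 0 ≤ t) (x : H) :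
    S.op (s + t) x = S.op s (S.op t x) := by
  rw [← S.op_mul s t hs ht]; rfl

/-- Otherwise the norms blow up along times tending to `0`, while every orbit converges there and is
bounded, against the uniform boundedness principle. -/
theorem exists_bound_near_zero :
    ∃ δ > 0, ∃ K : ℝ, 1 ≤ K ∧ ∀ t, 0 ≤ t → t ≤ δ → ‖S.op t‖ ≤ K := by
  by_contra! hcon
  have h : ∀ n : ℕ, ∃ t : ℝ, 0 ≤ t ∧ t ≤ 1 / (n + 1) ∧ (n + 1 : ℝ) < ‖S.op t‖ := fun n => by
    obtain ⟨t, h0, h1, h2⟩ := hcon (1 / (n + 1)) (by positivity) (n + 1) (by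
      have : (0 : ℝ) ≤ n := n.cast_nonneg
      linarith)
    exact ⟨t, h0, h1, h2⟩
  choose t h0 h1 h2 using h
  have ht : Tendsto t atTop (𝓝[≥] 0) :=
    tendsto_nhdsWithin_iff.2 ⟨squeeze_zero h0 h1 tendsto_one_div_add_atTop_nhds_zero_nat,
      Eventually.of_forall h0⟩
  obtain ⟨C, hC⟩ := banach_steinhaus (g := fun n => S.op (t n)) fun x => by
    obtain ⟨C, hC⟩ := ((S.tendsto_nhdsGE_zero x).comp ht).norm.bddAbove_range
    exact ⟨C, fun n => hC ⟨n, rfl⟩⟩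
  obtain ⟨n, hn⟩ := exists_nat_gt C
  have := hC n
  have := h2 n
  linarith

theorem exists_growth_bound :
    ∃ K ω : ℝ, 0 ≤ K ∧ 0 ≤ ω ∧ ∀ t, 0 ≤ t → ‖S.op t‖ ≤ K * Real.exp (ω * t) := by
  obtain ⟨δ, hδ, K, hK, hb⟩ := S.exists_bound_near_zero
  have hK0 : 0 < K := by linarith
  have key : ∀ n : ℕ, ∀ t, 0 ≤ t → t ≤ (n + 1) * δ → ‖S.op t‖ ≤ K ^ (n + 1) := by
    intro n
    induction n with
    | zero => intro t h0 h1; simpa using hb t h0 (by simpa using h1)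
    | succ n ih =>
      intro t h0 h1
      rcases le_or_gt t δ with h | h
      · exact (hb t h0 h).trans (le_self_pow₀ hK (by omega))
      · have h2 : S.op t = S.op δ * S.op (t - δ) := by
          rw [S.op_mul δ (t - δ) hδ.le (by linarith)]; congr 1; ring
        rw [h2, pow_succ']
        refine (norm_mul_le _ _).trans ?_
        gcongr
        · exact hb δ hδ.le le_rfl
        · refine ih _ (by linarith) ?_
          push_cast at h1
          linarith
  -- A time `t` is covered by `⌊t/δ⌋ + 1` steps of length `δ`, each costing a factor `K`; the rate
  -- `log K / δ` satisfies `K^(t/δ) = e^(ωt)`, and `K ≥ 1` makes it nonnegative.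
  refine ⟨K, Real.log K / δ, hK0.le, div_nonneg (Real.log_nonneg hK) hδ.le, fun t ht => ?_⟩
  have hn := Nat.floor_le (div_nonneg ht hδ.le)
  have hn' := (Nat.lt_floor_add_one (t / δ)).le
  rw [div_le_iff₀ hδ] at hn'
  refine (key _ t ht hn').trans ?_
  rw [pow_succ']
  gcongr
  rw [← Real.rpow_natCast, Real.rpow_def_of_pos hK0]
  refine Real.exp_le_exp.2 ?_
  calc Real.log K * (⌊t / δ⌋₊ : ℝ) ≤ Real.log K * (t / δ) :=
        mul_le_mul_of_nonneg_left hn (Real.log_nonneg hK)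
    _ = Real.log K / δ * t := by ring

theorem continuous_orbit (x : H) : Continuous fun t : ℝ => S.op (max t 0) x := by
  obtain ⟨K, ω, hK, hω, hb⟩ := S.exists_growth_bound
  have hd : ∀ s t : ℝ, 0 ≤ s → s ≤ t →
      ‖S.op t x - S.op s x‖ ≤ K * Real.exp (ω * s) * ‖S.op (t - s) x - x‖ := by
    intro s t hs hst
    have : S.op t x - S.op s x = S.op s (S.op (t - s) x - x) := by
      rw [map_sub, ← S.op_add_apply hs (by linarith)]
      congr 3; ring
    rw [this]
    exact ((S.op s).le_opNorm _).trans (by gcongr; exact hb s hs)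
  -- The exponential is kept at `s` for both orders of `s` and `t`, so the factor stays constant as
  -- `t → s`.
  have hd' : ∀ s t : ℝ, 0 ≤ s → 0 ≤ t →
      ‖S.op t x - S.op s x‖ ≤ K * Real.exp (ω * s) * ‖S.op |t - s| x - x‖ := by
    intro s t hs ht
    rcases le_total s t with h | h
    · rw [abs_of_nonneg (by linarith)]; exact hd s t hs h
    · rw [abs_of_nonpos (by linarith), norm_sub_rev, neg_sub]
      refine (hd t s ht h).trans ?_
      gcongr
  rw [continuous_iff_continuousAt]
  intro s
  rw [ContinuousAt, tendsto_iff_norm_sub_tendsto_zero]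
  refine squeeze_zero (fun _ => norm_nonneg _)
    (fun t => hd' (max s 0) (max t 0) (le_max_right _ _) (le_max_right _ _)) ?_
  have h1 : Tendsto (fun t : ℝ => |max t 0 - max s 0|) (𝓝 s) (𝓝[≥] 0) := by
    refine tendsto_nhdsWithin_iff.2 ⟨?_, Eventually.of_forall fun t => abs_nonneg (max t 0 - max s 0)⟩
    have : Continuous fun t : ℝ => |max t 0 - max s 0| := by fun_prop
    simpa using this.tendsto s
  have h2 := tendsto_iff_norm_sub_tendsto_zero.1 ((S.tendsto_nhdsGE_zero x).comp h1)
  simpa using h2.const_mul (K * Real.exp (ω * max s 0))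

end C0Semigroup

/-! ### Integral representation of the Wright function -/

section Wright

theorem exists_mul_rpow_le {α : ℝ} (h0 : 0 < α) (h1 : α < 1) (A : ℝ) {c : ℝ} (hc : 0 < c) :
    ∃ K : ℝ, ∀ t : ℝ, 0 ≤ t → A * t ^ α ≤ c * t + K := by
  have hA : 0 ≤ |A| / c := by positivity
  refine ⟨|A| * ((|A| / c) ^ (1 / (1 - α))) ^ α, fun t ht => ?_⟩
  -- The point where `|A| t^α = c t`: beyond it the linear term wins, before it the left side is at
  -- most its value at `T`.
  set T := (|A| / c) ^ (1 / (1 - α)) with hT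
  have hT0 : 0 ≤ T := Real.rpow_nonneg hA _
  have h1' : 0 < 1 - α := by linarith
  have hAt : A * t ^ α ≤ |A| * t ^ α := by
    gcongr
    exact le_abs_self A
  refine hAt.trans ?_
  rcases le_total t T with h | h
  · have : |A| * t ^ α ≤ |A| * T ^ α := by gcongr
    have : 0 ≤ c * t := by positivity
    linarith
  · have h2 : |A| / c ≤ t ^ (1 - α) := by
      calc |A| / c = T ^ (1 - α) := by
            rw [hT, ← Real.rpow_mul hA, one_div_mul_cancel h1'.ne', Real.rpow_one]
        _ ≤ t ^ (1 - α) := by gcongr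
    rw [div_le_iff₀ hc] at h2
    have h3 : t ^ (1 - α) * t ^ α = t := by
      rw [← Real.rpow_add_of_nonneg ht h1'.le h0.le]; simp
    have : 0 ≤ |A| * T ^ α := by positivity
    have : |A| * t ^ α ≤ t ^ (1 - α) * c * t ^ α := by gcongr
    nlinarith

/-- The integrand `t^(α-1) e^{iπα} exp(-t - θ t^α e^{iπα})` on the lower side of the cut. -/
noncomputable def cutIntegrand (α θ t : ℝ) : ℂ :=
  ((t ^ (α - 1) * Real.exp (-t) : ℝ) : ℂ) * Complex.exp (α * Real.pi * Complex.I) *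
    Complex.exp (-θ * (t ^ α : ℝ) * Complex.exp (α * Real.pi * Complex.I))

/-- The terms of the expansion of `cutIntegrand` in powers of `θ`. -/
noncomputable def cutTerm (α θ : ℝ) (n : ℕ) (t : ℝ) : ℂ :=
  ((t ^ (α - 1) * Real.exp (-t) : ℝ) : ℂ) * Complex.exp (α * Real.pi * Complex.I) *
    ((-θ * (t ^ α : ℝ) * Complex.exp (α * Real.pi * Complex.I)) ^ n / (n.factorial : ℂ))

theorem norm_cexp_ofReal_mul_pi (α : ℝ) : ‖Complex.exp (α * Real.pi * Complex.I)‖ = 1 := by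
  have := Complex.norm_exp_ofReal_mul_I (α * Real.pi)
  simpa using this

theorem hasSum_cutTerm (α θ t : ℝ) :
    HasSum (fun n => cutTerm α θ n t) (cutIntegrand α θ t) := by
  unfold cutTerm cutIntegrand
  refine HasSum.mul_left _ ?_
  rw [Complex.exp_eq_exp_ℂ]
  exact NormedSpace.expSeries_div_hasSum_exp _

theorem norm_cutTerm {α θ : ℝ} (n : ℕ) {t : ℝ} (ht : 0 < t) :
    ‖cutTerm α θ n t‖ = t ^ (α - 1) * Real.exp (-t) * ((|θ| * t ^ α) ^ n / n.factorial) := by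
  have h1 : 0 ≤ t ^ (α - 1) := Real.rpow_nonneg ht.le _
  have h2 : 0 ≤ t ^ α := Real.rpow_nonneg ht.le _
  unfold cutTerm
  simp only [norm_mul, norm_div, norm_pow, norm_neg, norm_cexp_ofReal_mul_pi, Complex.norm_real,
    Real.norm_eq_abs, mul_one, Complex.norm_natCast]
  rw [abs_of_nonneg h1, abs_of_nonneg h2, abs_of_pos (Real.exp_pos _)]

theorem hasSum_norm_cutTerm (α θ t : ℝ) :
    HasSum (fun n : ℕ => t ^ (α - 1) * Real.exp (-t) * ((|θ| * t ^ α) ^ n / n.factorial))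
      (t ^ (α - 1) * Real.exp (-t) * Real.exp (|θ| * t ^ α)) := by
  refine HasSum.mul_left _ ?_
  rw [Real.exp_eq_exp_ℝ]
  exact NormedSpace.expSeries_div_hasSum_exp _

/-- Since `α < 1`, half of the decay of `e^(-t)` absorbs `e^(|θ| t^α)`; `α > 0` gives integrability
at `0`. -/
theorem integrableOn_cut_bound {α : ℝ} (h0 : 0 < α) (h1 : α < 1) (θ : ℝ) :
    IntegrableOn (fun t : ℝ => t ^ (α - 1) * Real.exp (-t) * Real.exp (|θ| * t ^ α))
      (Set.Ioi 0) := by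
  obtain ⟨K, hK⟩ := exists_mul_rpow_le h0 h1 |θ| (c := 1 / 2) (by norm_num)
  have h := (integrableOn_rpow_mul_exp_neg_mul_rpow (p := 1) (s := α - 1) (b := 1 / 2)
    (by linarith) one_pos (by norm_num)).mul_const (Real.exp K)
  refine Integrable.mono' h (by fun_prop) ?_
  filter_upwards [ae_restrict_mem measurableSet_Ioi] with t ht
  have ht : 0 < t := ht
  have h3 : 0 ≤ t ^ (α - 1) := Real.rpow_nonneg ht.le _
  rw [Real.norm_of_nonneg (by positivity), mul_assoc, mul_assoc, ← Real.exp_add, ← Real.exp_add,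
    Real.rpow_one]
  exact mul_le_mul_of_nonneg_left (Real.exp_le_exp.2 (by linarith [hK t ht.le])) h3

theorem measurable_cutTerm (α θ : ℝ) (n : ℕ) : Measurable (cutTerm α θ n) := by
  unfold cutTerm
  fun_prop

theorem measurable_cutIntegrand (α θ : ℝ) : Measurable (cutIntegrand α θ) := by
  unfold cutIntegrand
  fun_prop

theorem integrableOn_cutIntegrand {α : ℝ} (h0 : 0 < α) (h1 : α < 1) (θ : ℝ) :
    IntegrableOn (cutIntegrand α θ) (Set.Ioi 0) := by
  refine Integrable.mono' (integrableOn_cut_bound h0 h1 θ)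
    (measurable_cutIntegrand α θ).aestronglyMeasurable ?_
  filter_upwards [ae_restrict_mem measurableSet_Ioi] with t ht
  have h := hasSum_norm_cutTerm α θ t
  rw [← (hasSum_cutTerm α θ t).tsum_eq, ← h.tsum_eq]
  have h' : (fun n : ℕ => t ^ (α - 1) * Real.exp (-t) * ((|θ| * t ^ α) ^ n / n.factorial))
      = fun n => ‖cutTerm α θ n t‖ := by
    funext n; rw [norm_cutTerm n ht]
  rw [h'] at h ⊢
  exact norm_tsum_le_tsum_norm h.summable

theorem hasSum_integral_cutTerm {α : ℝ} (h0 : 0 < α) (h1 : α < 1) (θ : ℝ) :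
    HasSum (fun n => ∫ t in Set.Ioi (0 : ℝ), cutTerm α θ n t)
      (∫ t in Set.Ioi (0 : ℝ), cutIntegrand α θ t) := by
  refine hasSum_integral_of_dominated_convergence
    (fun n t => t ^ (α - 1) * Real.exp (-t) * ((|θ| * t ^ α) ^ n / n.factorial))
    (fun n => (measurable_cutTerm α θ n).aestronglyMeasurable) (fun n => ?_)
    (Eventually.of_forall fun t => (hasSum_norm_cutTerm α θ t).summable) ?_
    (Eventually.of_forall fun t => hasSum_cutTerm α θ t)
  · filter_upwards [ae_restrict_mem measurableSet_Ioi] with t ht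
    exact (norm_cutTerm n ht).le
  · simp_rw [(hasSum_norm_cutTerm α θ _).tsum_eq]
    exact integrableOn_cut_bound h0 h1 θ

/-- The reflection formula. At the poles of `Γ(1 - s)` both sides are `0`, the left one by the
conventions for `Real.Gamma` and inversion. -/
theorem inv_Gamma_one_sub {s : ℝ} (hs : 0 < s) :
    (Real.Gamma (1 - s))⁻¹ = Real.Gamma s * Real.sin (Real.pi * s) / Real.pi := by
  have h := Real.Gamma_mul_Gamma_one_sub s
  have hG := (Real.Gamma_pos_of_pos hs).ne'
  have h2 : Real.Gamma (1 - s) = Real.pi / Real.sin (Real.pi * s) / Real.Gamma s := by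
    rw [← h, mul_div_cancel_left₀ _ hG]
  rw [h2, inv_div, div_div_eq_mul_div]

/-- With `s = α (n + 1)`, Euler's integral produces `Γ(s)` and the phase `e^(iπs)` contributes `sin
(π s)`; by reflection their product is `π / Γ(1 - s)`. -/
theorem im_integral_cutTerm {α : ℝ} (h0 : 0 < α) (θ : ℝ) (n : ℕ) :
    (∫ t in Set.Ioi (0 : ℝ), cutTerm α θ n t).im = Real.pi * wrightTerm α θ n := by
  have hs : 0 < α * (n + 1) := by positivity
  have h : ∀ t ∈ Set.Ioi (0 : ℝ), cutTerm α θ n t =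
      ((t ^ (α * (n + 1) - 1) * Real.exp (-(1 * t)) : ℝ) : ℂ) *
        ((((-θ) ^ n / n.factorial : ℝ) : ℂ) *
          Complex.exp ((Real.pi * (α * (n + 1)) : ℝ) * Complex.I)) := by
    intro t ht
    have e1 : t ^ (α * (n + 1) - 1) = t ^ (α - 1) * (t ^ α) ^ n := by
      rw [← Real.rpow_mul_natCast (le_of_lt ht), ← Real.rpow_add ht]
      congr 1; ring
    have e2 : Complex.exp ((Real.pi * (α * (n + 1)) : ℝ) * Complex.I) =
        Complex.exp (α * Real.pi * Complex.I) * Complex.exp (α * Real.pi * Complex.I) ^ n := by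
      rw [← Complex.exp_nat_mul, ← Complex.exp_add]
      congr 1; push_cast; ring
    rw [e1, e2, cutTerm, one_mul]
    push_cast
    ring
  rw [setIntegral_congr_fun measurableSet_Ioi h, integral_mul_const, integral_complex_ofReal,
    Real.integral_rpow_mul_exp_neg_mul_Ioi hs one_pos, Complex.im_ofReal_mul,
    Complex.im_ofReal_mul, Complex.exp_ofReal_mul_I_im, wrightTerm,
    show -α * n + 1 - α = 1 - α * (n + 1) by ring, div_eq_mul_inv _ (_ * Real.Gamma _),
    mul_inv, inv_Gamma_one_sub hs]
  have := Real.pi_ne_zero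
  field_simp
  simp

theorem hasSum_wrightTerm {α : ℝ} (h0 : 0 < α) (h1 : α < 1) (θ : ℝ) :
    HasSum (wrightTerm α θ) ((∫ t in Set.Ioi (0 : ℝ), cutIntegrand α θ t).im / Real.pi) := by
  have h := Complex.hasSum_im (hasSum_integral_cutTerm h0 h1 θ)
  simp_rw [im_integral_cutTerm h0] at h
  have h2 := h.div_const Real.pi
  simpa [mul_div_cancel_left₀ _ Real.pi_ne_zero] using h2

theorem wright_eq {α : ℝ} (h0 : 0 < α) (h1 : α < 1) (θ : ℝ) :
    wright α θ = (∫ t in Set.Ioi (0 : ℝ), cutIntegrand α θ t).im / Real.pi :=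
  (hasSum_wrightTerm h0 h1 θ).tsum_eq

theorem measurable_wright {α : ℝ} (h0 : 0 < α) (h1 : α < 1) : Measurable (wright α) := by
  refine measurable_of_tendsto_metrizable (f := fun N θ => ∑ n ∈ Finset.range N, wrightTerm α θ n)
    (fun N => ?_) (tendsto_pi_nhds.2 fun θ =>
      (hasSum_wrightTerm h0 h1 θ).summable.hasSum.tendsto_sum_nat)
  unfold wrightTerm
  fun_prop

end Wright

/-! ### Superexponential decay by contour deformation -/

section WrightDecay

/-- The Hankel integrand `σ^α e^σ e^{-θ σ^α}` in the logarithmic coordinate `z = log σ`, in which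
it is entire. -/
noncomputable def hankelIntegrand (α θ : ℝ) (z : ℂ) : ℂ :=
  Complex.exp (α * z + Complex.exp z - θ * Complex.exp (α * z))

theorem differentiable_hankelIntegrand (α θ : ℝ) : Differentiable ℂ (hankelIntegrand α θ) := by
  unfold hankelIntegrand
  fun_prop

theorem norm_hankelIntegrand (α θ x y : ℝ) :
    ‖hankelIntegrand α θ (x + y * Complex.I)‖ =
      Real.exp (α * x + Real.exp x * Real.cos y - θ * (Real.exp (α * x) * Real.cos (α * y))) := by
  have h : (α : ℂ) * (x + y * Complex.I) = ((α * x : ℝ) : ℂ) + ((α * y : ℝ) : ℂ) * Complex.I := by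
    push_cast; ring
  rw [hankelIntegrand, Complex.norm_exp, h]
  simp [Complex.exp_re]

theorem im_hankelIntegrand_ofReal (α θ x : ℝ) : (hankelIntegrand α θ x).im = 0 := by
  have : hankelIntegrand α θ x =
      ((Real.exp (α * x + Real.exp x - θ * Real.exp (α * x)) : ℝ) : ℂ) := by
    simp [hankelIntegrand]
  rw [this, Complex.ofReal_im]

/-- The substitution `t = e^x`, Jacobian included, places the integrand on the line `Im z = π`. -/
theorem exp_smul_cutIntegrand (α θ x : ℝ) :
    Real.exp x • cutIntegrand α θ (Real.exp x) =
      hankelIntegrand α θ (x + Real.pi * Complex.I) := by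
  have h1 : Complex.exp (x + Real.pi * Complex.I) = -Complex.exp x := by
    rw [Complex.exp_add, Complex.exp_pi_mul_I]; ring
  have h2 : Complex.exp (α * (x + Real.pi * Complex.I)) =
      Complex.exp (α * x) * Complex.exp (α * Real.pi * Complex.I) := by
    rw [← Complex.exp_add]; congr 1; ring
  have h3 : Real.exp x * (Real.exp x) ^ (α - 1) = Real.exp (α * x) := by
    rw [← Real.exp_mul, ← Real.exp_add]; congr 1; ring
  have h4 : (Real.exp x) ^ α = Real.exp (α * x) := by
    rw [← Real.exp_mul]; congr 1; ring
  rw [cutIntegrand, h4, hankelIntegrand, h2, h1, Complex.real_smul, ← mul_assoc, ← mul_assoc,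
    ← Complex.ofReal_mul, ← mul_assoc, h3]
  rw [show (α : ℂ) * (x + Real.pi * Complex.I) + -Complex.exp x -
      θ * (Complex.exp (α * x) * Complex.exp (α * Real.pi * Complex.I)) =
      α * x + -Complex.exp x + α * Real.pi * Complex.I +
        -θ * Complex.exp (α * x) * Complex.exp (α * Real.pi * Complex.I) by ring,
    Complex.exp_add, Complex.exp_add, Complex.exp_add]
  push_cast
  rfl

/-- Cauchy's theorem on `[X, L] × [0, π]` and `[L, Y] × [φ, π]`. The integrand is real on the real
axis, so the bottom side of the first rectangle drops out of the imaginary part; vertical sides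
carry a factor `i`, whence their real parts. -/
theorem hankel_contour (α θ φ X Y L : ℝ) :
    (∫ x in X..Y, hankelIntegrand α θ (x + Real.pi * Complex.I)).im =
      (∫ x in L..Y, hankelIntegrand α θ (x + φ * Complex.I)).im
      + (∫ y in φ..Real.pi, hankelIntegrand α θ (Y + y * Complex.I)).re
      + (∫ y in (0 : ℝ)..φ, hankelIntegrand α θ (L + y * Complex.I)).re
      - (∫ y in (0 : ℝ)..Real.pi, hankelIntegrand α θ (X + y * Complex.I)).re := by
  have hd := differentiable_hankelIntegrand α θ
  have hc := hd.continuous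
  have r1 := Complex.integral_boundary_rect_eq_zero_of_differentiableOn (hankelIntegrand α θ)
    (X : ℂ) (L + Real.pi * Complex.I) hd.differentiableOn
  have r2 := Complex.integral_boundary_rect_eq_zero_of_differentiableOn (hankelIntegrand α θ)
    (L + φ * Complex.I) (Y + Real.pi * Complex.I) hd.differentiableOn
  have hcx : ∀ y : ℝ, Continuous fun x : ℝ => hankelIntegrand α θ (x + y * Complex.I) :=
    fun y => hc.comp (by fun_prop)
  have hcy : ∀ x : ℝ, Continuous fun y : ℝ => hankelIntegrand α θ (x + y * Complex.I) :=
    fun y => hc.comp (by fun_prop)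
  have s1 := intervalIntegral.integral_add_adjacent_intervals
    ((hcx Real.pi).intervalIntegrable (μ := volume) X L)
    ((hcx Real.pi).intervalIntegrable (μ := volume) L Y)
  have s2 := intervalIntegral.integral_add_adjacent_intervals
    ((hcy L).intervalIntegrable (μ := volume) 0 φ)
    ((hcy L).intervalIntegrable (μ := volume) φ Real.pi)
  have hre : (∫ x in X..L, hankelIntegrand α θ (x + (0 : ℝ) * Complex.I)).im = 0 := by
    have h0 : ∀ x : ℝ, hankelIntegrand α θ (x + (0 : ℝ) * Complex.I) =
        (((hankelIntegrand α θ x).re : ℝ) : ℂ) := fun x => by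
      rw [Complex.ofReal_zero, zero_mul, add_zero]
      exact Complex.ext (by simp) (by simp [im_hankelIntegrand_ofReal])
    simp_rw [h0]
    rw [intervalIntegral.integral_ofReal, Complex.ofReal_im]
  have r1' := congrArg Complex.im r1
  have r2' := congrArg Complex.im r2
  have s1' := congrArg Complex.im s1
  have s2' := congrArg Complex.re s2
  simp only [Complex.add_im, Complex.add_re, Complex.sub_im, smul_eq_mul,
    Complex.ofReal_re, Complex.ofReal_im, Complex.mul_re, Complex.mul_im, Complex.I_re,
    Complex.I_im, mul_zero, mul_one, zero_mul, add_zero, zero_add, sub_self,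
    Complex.zero_im] at r1' r2' s1' s2' hre
  linarith

theorem tendsto_integral_hankelIntegrand {α : ℝ} (h0 : 0 < α) (h1 : α < 1) (θ : ℝ) :
    Tendsto (fun N : ℕ => ∫ x in (-(N : ℝ))..N, hankelIntegrand α θ (x + Real.pi * Complex.I))
      atTop (𝓝 (∫ t in Set.Ioi (0 : ℝ), cutIntegrand α θ t)) := by
  have hi := integrableOn_cutIntegrand h0 h1 θ
  rw [← Real.range_exp, ← Set.image_univ] at hi ⊢
  have hder : ∀ x ∈ (Set.univ : Set ℝ), HasDerivWithinAt Real.exp (Real.exp x) Set.univ x :=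
    fun x _ => (Real.hasDerivAt_exp x).hasDerivWithinAt
  rw [integral_image_eq_integral_abs_deriv_smul MeasurableSet.univ hder
    Real.exp_injective.injOn]
  rw [integrableOn_image_iff_integrableOn_abs_deriv_smul MeasurableSet.univ hder
    Real.exp_injective.injOn] at hi
  simp only [abs_of_pos (Real.exp_pos _), exp_smul_cutIntegrand, Measure.restrict_univ,
    integrableOn_univ] at hi ⊢
  exact intervalIntegral_tendsto_integral hi
    (tendsto_neg_atTop_atBot.comp tendsto_natCast_atTop_atTop) tendsto_natCast_atTop_atTop

theorem exists_mul_exp_le {α : ℝ} (h0 : 0 < α) (h1 : α < 1) (A : ℝ) {c : ℝ} (hc : 0 < c) :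
    ∃ K : ℝ, ∀ x : ℝ, α * x + A * Real.exp (α * x) ≤ c * Real.exp x + K := by
  obtain ⟨K, hK⟩ := exists_mul_rpow_le h0 h1 (1 + A) hc
  refine ⟨K, fun x => ?_⟩
  have h := hK _ (Real.exp_pos x).le
  rw [← Real.exp_mul, mul_comm x α] at h
  have := Real.add_one_le_exp (α * x)
  linarith

/-- The Wright function decays faster than any exponential. -/
theorem wright_decay {α : ℝ} (h0 : 0 < α) (h1 : α < 1) (r : ℝ) :
    ∃ C : ℝ, 0 ≤ C ∧ ∀ θ : ℝ, 0 ≤ θ → |wright α θ| ≤ C * Real.exp (-(r * θ)) := by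
  have hpi := Real.pi_pos
  -- Then `α φ = π - φ`, so `π/2 < φ < π` and `α φ < π/2`: on the line at height `φ`, `cos φ < 0`
  -- gives decay in `x` and `cos (α φ) > 0` gives decay in `θ`.
  set φ := Real.pi / (1 + α) with hφ
  have hφ1 : Real.pi / 2 < φ := by rw [hφ]; gcongr; linarith
  have hφ2 : φ < Real.pi := by rw [hφ, div_lt_iff₀ (by linarith)]; nlinarith
  have hφ3 : α * φ < Real.pi / 2 := by
    have : α * φ = Real.pi - φ := by rw [hφ]; field_simp; ring
    linarith
  have hφ0 : 0 < φ := by linarith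
  set κ := Real.cos (α * φ) with hκ
  have hκ0 : 0 < κ := Real.cos_pos_of_mem_Ioo ⟨by nlinarith, hφ3⟩
  obtain ⟨c, hc⟩ : ∃ c, c = -Real.cos φ := ⟨_, rfl⟩
  have hc0 : 0 < c := by
    have := Real.cos_neg_of_pi_div_two_lt_of_lt hφ1 (by linarith)
    linarith
  -- `L` depends on `r` but not on `θ`: to the right of `L` the decay rate in `θ` is at least `r`.
  obtain ⟨L, hL⟩ : ∃ L : ℝ, r ≤ κ * Real.exp (α * L) := by
    have : Tendsto (fun L : ℝ => κ * Real.exp (α * L)) atTop atTop :=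
      (Real.tendsto_exp_atTop.comp (tendsto_id.const_mul_atTop h0)).const_mul_atTop hκ0
    exact (this.eventually_ge_atTop r).exists
  obtain ⟨K₀, hK₀⟩ := exists_mul_exp_le h0 h1 0 (half_pos hc0)
  have hint : IntegrableOn (fun x => Real.exp (α * x - c * Real.exp x)) (Set.Ioi L) := by
    refine Integrable.mono' ((exp_neg_integrableOn_Ioi L (half_pos hc0)).const_mul (Real.exp K₀))
      (by fun_prop) (Eventually.of_forall fun x => ?_)
    rw [Real.norm_of_nonneg (Real.exp_pos _).le, ← Real.exp_add]
    refine Real.exp_le_exp.2 ?_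
    have := hK₀ x
    have := mul_le_mul_of_nonneg_left (Real.add_one_le_exp x) (half_pos hc0).le
    linarith
  set J := ∫ x in Set.Ioi L, Real.exp (α * x - c * Real.exp x) with hJ
  have hJ0 : 0 ≤ J := setIntegral_nonneg measurableSet_Ioi fun x _ => (Real.exp_pos _).le
  refine ⟨(J + Real.exp (α * L + Real.exp L) * φ) / Real.pi, by positivity, fun θ hθ => ?_⟩
  set d := Real.exp (-(r * θ)) with hd
  have hdL : Real.exp (-(θ * (κ * Real.exp (α * L)))) ≤ d := by
    refine Real.exp_le_exp.2 ?_
    nlinarith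
  have bA : ∀ Y : ℝ, L ≤ Y →
      ‖∫ x in L..Y, hankelIntegrand α θ (x + φ * Complex.I)‖ ≤ d * J := by
    intro Y hLY
    rw [intervalIntegral.integral_of_le hLY]
    calc ‖∫ x in Set.Ioc L Y, hankelIntegrand α θ (x + φ * Complex.I)‖
        ≤ ∫ x in Set.Ioc L Y, d * Real.exp (α * x - c * Real.exp x) := by
          refine norm_integral_le_of_norm_le
            ((hint.mono_set Set.Ioc_subset_Ioi_self).const_mul d) ?_
          filter_upwards [ae_restrict_mem measurableSet_Ioc] with x hx
          rw [norm_hankelIntegrand]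
          refine le_trans ?_ (mul_le_mul_of_nonneg_right hdL (Real.exp_pos _).le)
          rw [← Real.exp_add]
          refine Real.exp_le_exp.2 ?_
          have h5 : Real.exp (α * L) ≤ Real.exp (α * x) :=
            Real.exp_le_exp.2 (mul_le_mul_of_nonneg_left hx.1.le h0.le)
          have h6 : θ * (κ * Real.exp (α * L)) ≤ θ * (Real.exp (α * x) * Real.cos (α * φ)) := by
            rw [← hκ, mul_comm (Real.exp (α * x))]
            gcongr
          have h7 : Real.exp x * Real.cos φ = -(c * Real.exp x) := by rw [hc]; ring
          linarith
      _ = d * ∫ x in Set.Ioc L Y, Real.exp (α * x - c * Real.exp x) := integral_const_mul _ _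
      _ ≤ d * J := by
          refine mul_le_mul_of_nonneg_left ?_ (Real.exp_pos _).le
          exact setIntegral_mono_set hint (Eventually.of_forall fun x => (Real.exp_pos _).le)
            (LE.le.eventuallyLE (Set.Ioc_subset_Ioi_self : Set.Ioc L Y ⊆ Set.Ioi L))
  have bC : ‖∫ y in (0 : ℝ)..φ, hankelIntegrand α θ (L + y * Complex.I)‖ ≤
      d * (Real.exp (α * L + Real.exp L) * φ) := by
    have := intervalIntegral.norm_integral_le_of_norm_le_const (a := 0) (b := φ)
      (C := d * Real.exp (α * L + Real.exp L))
      (f := fun y : ℝ => hankelIntegrand α θ (L + y * Complex.I)) (fun y hy => by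
        rw [Set.uIoc_of_le hφ0.le] at hy
        rw [norm_hankelIntegrand]
        refine le_trans ?_ (mul_le_mul_of_nonneg_right hdL (Real.exp_pos _).le)
        rw [← Real.exp_add]
        refine Real.exp_le_exp.2 ?_
        have h5 : κ ≤ Real.cos (α * y) :=
          Real.cos_le_cos_of_nonneg_of_le_pi (mul_nonneg h0.le hy.1.le) (by linarith)
            (mul_le_mul_of_nonneg_left hy.2 h0.le)
        have h6 : θ * (κ * Real.exp (α * L)) ≤ θ * (Real.exp (α * L) * Real.cos (α * y)) := by
          rw [mul_comm κ]
          gcongr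
        have h7 := mul_le_mul_of_nonneg_left (Real.cos_le_one y) (Real.exp_pos L).le
        linarith)
    rwa [sub_zero, abs_of_pos hφ0, mul_assoc] at this
  -- This `K` may depend on `θ`, because the side at `Y` vanishes in the limit with `θ` fixed; the
  -- same holds for the side at `X`.
  obtain ⟨K, hK⟩ := exists_mul_exp_le h0 h1 θ (half_pos hc0)
  have bB : ∀ Y : ℝ, ‖∫ y in φ..Real.pi, hankelIntegrand α θ (Y + y * Complex.I)‖ ≤
      Real.exp (K - c / 2 * Real.exp Y) * (Real.pi - φ) := by
    intro Y
    have := intervalIntegral.norm_integral_le_of_norm_le_const (a := φ) (b := Real.pi)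
      (C := Real.exp (K - c / 2 * Real.exp Y))
      (f := fun y : ℝ => hankelIntegrand α θ (Y + y * Complex.I)) (fun y hy => by
        rw [Set.uIoc_of_le hφ2.le] at hy
        rw [norm_hankelIntegrand]
        refine Real.exp_le_exp.2 ?_
        have h5 : Real.cos y ≤ -c := by
          rw [hc, neg_neg]
          exact Real.cos_le_cos_of_nonneg_of_le_pi hφ0.le hy.2 hy.1.le
        have h6 : θ * (Real.exp (α * Y) * (-1)) ≤ θ * (Real.exp (α * Y) * Real.cos (α * y)) := by
          gcongr
          exact Real.neg_one_le_cos _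
        have h7 := mul_le_mul_of_nonneg_left h5 (Real.exp_pos Y).le
        have := hK Y
        linarith)
    rwa [abs_of_pos (by linarith)] at this
  have bD : ∀ X : ℝ, X ≤ 0 → ‖∫ y in (0 : ℝ)..Real.pi, hankelIntegrand α θ (X + y * Complex.I)‖ ≤
      Real.exp (α * X + (1 + θ)) * Real.pi := by
    intro X hX
    have := intervalIntegral.norm_integral_le_of_norm_le_const (a := 0) (b := Real.pi)
      (C := Real.exp (α * X + (1 + θ)))
      (f := fun y : ℝ => hankelIntegrand α θ (X + y * Complex.I)) (fun y hy => by
        rw [norm_hankelIntegrand]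
        refine Real.exp_le_exp.2 ?_
        have h5 : θ * (Real.exp (α * X) * (-1)) ≤ θ * (Real.exp (α * X) * Real.cos (α * y)) := by
          gcongr
          exact Real.neg_one_le_cos _
        have h6 := mul_le_mul_of_nonneg_left (Real.cos_le_one y) (Real.exp_pos X).le
        have h7 : Real.exp X ≤ 1 := Real.exp_le_one_iff.2 hX
        have h8 : Real.exp (α * X) ≤ 1 :=
          Real.exp_le_one_iff.2 (mul_nonpos_of_nonneg_of_nonpos h0.le hX)
        nlinarith)
    rwa [sub_zero, abs_of_pos hpi] at this
  have hlim := (Complex.continuous_im.tendsto _).comp (tendsto_integral_hankelIntegrand h0 h1 θ)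
  have hN : Tendsto (fun N : ℕ => (N : ℝ)) atTop atTop := tendsto_natCast_atTop_atTop
  have hub : Tendsto (fun N : ℕ => d * J + Real.exp (K - c / 2 * Real.exp N) * (Real.pi - φ)
      + d * (Real.exp (α * L + Real.exp L) * φ)
      + Real.exp (α * (-(N : ℝ)) + (1 + θ)) * Real.pi) atTop
      (𝓝 (d * J + 0 * (Real.pi - φ) + d * (Real.exp (α * L + Real.exp L) * φ)
        + 0 * Real.pi)) := by
    refine (((Tendsto.mul_const _ ?_).const_add _).add_const _).add (Tendsto.mul_const _ ?_)
    · refine Real.tendsto_exp_atBot.comp (tendsto_atBot_add_const_left _ _ ?_)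
      exact tendsto_neg_atTop_atBot.comp
        ((Real.tendsto_exp_atTop.comp hN).const_mul_atTop (half_pos hc0))
    · refine Real.tendsto_exp_atBot.comp (tendsto_atBot_add_const_right _ _ ?_)
      exact (tendsto_neg_atTop_atBot.comp hN).const_mul_atBot h0
  have hle := le_of_tendsto_of_tendsto hlim.abs hub (by
    filter_upwards [hN.eventually_ge_atTop L, hN.eventually_ge_atTop 0] with N hNL hN0
    simp only [Function.comp]
    rw [hankel_contour α θ φ _ _ L]
    refine (abs_sub _ _).trans ?_
    refine add_le_add ((abs_add_three _ _ _).trans ?_) ((Complex.abs_re_le_norm _).trans ?_)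
    · exact add_le_add (add_le_add ((Complex.abs_im_le_norm _).trans (bA _ hNL))
        ((Complex.abs_re_le_norm _).trans (bB _))) ((Complex.abs_re_le_norm _).trans bC)
    · have := bD (-(N : ℝ)) (by linarith)
      exact this)
  rw [wright_eq h0 h1, abs_div, abs_of_pos hpi, div_mul_eq_mul_div]
  refine div_le_div_of_nonneg_right ?_ hpi.le
  refine hle.trans (le_of_eq ?_)
  ring

end WrightDecay

/-! ### The families `𝒮_α` and `𝒫_α` -/

section FractionalFamilies

/-- A measurable weight on `[0, ∞)` that decays faster than any exponential. -/
structure IsRapidWeight (w : ℝ → ℝ) : Prop where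
  measurable : Measurable w
  decay : ∀ r : ℝ, ∃ C : ℝ, 0 ≤ C ∧ ∀ θ : ℝ, 0 ≤ θ → |w θ| ≤ C * Real.exp (-(r * θ))

theorem isRapidWeight_wright {α : ℝ} (h0 : 0 < α) (h1 : α < 1) : IsRapidWeight (wright α) :=
  ⟨measurable_wright h0 h1, wright_decay h0 h1⟩

theorem IsRapidWeight.const_mul_id_mul {w : ℝ → ℝ} (hw : IsRapidWeight w) {a : ℝ} (ha : 0 ≤ a) :
    IsRapidWeight fun θ => a * θ * w θ := by
  refine ⟨(measurable_const.mul measurable_id).mul hw.measurable, fun r => ?_⟩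
  -- The extra unit of decay pays for the factor `θ ≤ e^θ`.
  obtain ⟨C, hC, h⟩ := hw.decay (r + 1)
  refine ⟨a * C, by positivity, fun θ hθ => ?_⟩
  rw [abs_mul, abs_of_nonneg (by positivity)]
  have h2 : θ ≤ Real.exp θ := by linarith [Real.add_one_le_exp θ]
  calc a * θ * |w θ| ≤ a * Real.exp θ * (C * Real.exp (-((r + 1) * θ))) := by
        gcongr
        exact h θ hθ
    _ = a * C * (Real.exp θ * Real.exp (-((r + 1) * θ))) := by ring
    _ = a * C * Real.exp (-(r * θ)) := by rw [← Real.exp_add]; congr 2; ring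

variable {H : Type*} [NormedAddCommGroup H] [InnerProductSpace ℝ H] [CompleteSpace H]
  (S : C0Semigroup H)

/-- A weight decaying at rate `ω A + 1` beats the growth `e^(ω A θ)` and leaves `e^(-θ)`. Uniformity
in `a ≤ A` supplies the dominating function for continuity in time. -/
theorem IsRapidWeight.exists_bound {w : ℝ → ℝ} (hw : IsRapidWeight w) (A : ℝ) :
    ∃ C : ℝ, ∀ a : ℝ, 0 ≤ a → a ≤ A → ∀ θ : ℝ, 0 ≤ θ → ∀ x : H,
      ‖w θ • S.op (a * θ) x‖ ≤ C * Real.exp (-θ) * ‖x‖ := by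
  obtain ⟨K, ω, hK, hω, hb⟩ := S.exists_growth_bound
  obtain ⟨C, hC, h⟩ := hw.decay (ω * A + 1)
  refine ⟨C * K, fun a ha haA θ hθ x => ?_⟩
  rw [norm_smul, Real.norm_eq_abs]
  calc |w θ| * ‖S.op (a * θ) x‖
      ≤ (C * Real.exp (-((ω * A + 1) * θ))) * (K * Real.exp (ω * (A * θ)) * ‖x‖) := by
        gcongr
        · exact h θ hθ
        · refine ((S.op (a * θ)).le_opNorm x).trans ?_
          gcongr
          refine (hb _ (by positivity)).trans ?_
          gcongr
    _ = C * K * (Real.exp (-((ω * A + 1) * θ)) * Real.exp (ω * (A * θ))) * ‖x‖ := by ring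
    _ = C * K * Real.exp (-θ) * ‖x‖ := by rw [← Real.exp_add]; congr 3; ring

theorem IsRapidWeight.aestronglyMeasurable {w : ℝ → ℝ} (hw : IsRapidWeight w) {a : ℝ} (ha : 0 ≤ a)
    (x : H) : AEStronglyMeasurable (fun θ => w θ • S.op (a * θ) x)
      (volume.restrict (Set.Ioi 0)) := by
  have h : AEStronglyMeasurable (fun θ => w θ • S.op (max (a * θ) 0) x)
      (volume.restrict (Set.Ioi 0)) :=
    hw.measurable.aestronglyMeasurable.smul
      ((S.continuous_orbit x).comp (continuous_const.mul continuous_id)).aestronglyMeasurable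
  refine h.congr ?_
  filter_upwards [ae_restrict_mem measurableSet_Ioi] with θ hθ
  rw [max_eq_left (mul_nonneg ha (le_of_lt hθ))]

theorem integrableOn_exp_neg_bound (C D : ℝ) :
    IntegrableOn (fun θ : ℝ => C * Real.exp (-θ) * D) (Set.Ioi 0) := by
  have h := ((exp_neg_integrableOn_Ioi 0 one_pos).const_mul C).mul_const D
  simpa [IntegrableOn] using h

theorem IsRapidWeight.stronglyIntegrable {w : ℝ → ℝ} (hw : IsRapidWeight w) {a : ℝ} (ha : 0 ≤ a) :
    StronglyIntegrable (volume.restrict (Set.Ioi 0)) fun θ => w θ • S.op (a * θ) := by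
  intro x
  obtain ⟨C, hC⟩ := hw.exists_bound S a
  refine Integrable.mono' (integrableOn_exp_neg_bound C ‖x‖) (hw.aestronglyMeasurable S ha x) ?_
  filter_upwards [ae_restrict_mem measurableSet_Ioi] with θ hθ
  exact hC a ha le_rfl θ (le_of_lt hθ) x

theorem IsRapidWeight.continuous_integral {w : ℝ → ℝ} (hw : IsRapidWeight w) {f : ℝ → ℝ}
    (hf : Continuous f) (hf0 : ∀ t, 0 ≤ f t) (x : H) :
    Continuous fun t => ∫ θ in Set.Ioi (0 : ℝ), w θ • S.op (f t * θ) x := by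
  rw [continuous_iff_continuousAt]
  intro t
  obtain ⟨C, hC⟩ := hw.exists_bound S (f t + 1)
  refine continuousAt_of_dominated (bound := fun θ => C * Real.exp (-θ) * ‖x‖)
    (Eventually.of_forall fun s => hw.aestronglyMeasurable S (hf0 s) x) ?_
    (integrableOn_exp_neg_bound C ‖x‖) ?_
  · filter_upwards [(hf.tendsto t).eventually_le_const (lt_add_one (f t))] with s hs
    filter_upwards [ae_restrict_mem measurableSet_Ioi] with θ hθ
    exact hC (f s) (hf0 s) hs θ (le_of_lt hθ) x
  · filter_upwards [ae_restrict_mem measurableSet_Ioi] with θ hθ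
    have h : Continuous fun s => S.op (max (f s * θ) 0) x :=
      (S.continuous_orbit x).comp (hf.mul continuous_const)
    have h2 : (fun s => S.op (max (f s * θ) 0) x) = fun s => S.op (f s * θ) x := by
      funext s
      rw [max_eq_left (mul_nonneg (hf0 s) (le_of_lt hθ))]
    rw [h2] at h
    exact (h.const_smul (w θ)).continuousAt

theorem stronglyIntegrable_fracSKernel {α : ℝ} (h0 : 0 < α) (h1 : α < 1) {t : ℝ} (ht : 0 ≤ t) :
    StronglyIntegrable (volume.restrict (Set.Ioi 0)) (fracSKernel α S t) :=
  (isRapidWeight_wright h0 h1).stronglyIntegrable S (Real.rpow_nonneg ht α)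

theorem stronglyIntegrable_fracPKernel {α : ℝ} (h0 : 0 < α) (h1 : α < 1) {t : ℝ} (ht : 0 ≤ t) :
    StronglyIntegrable (volume.restrict (Set.Ioi 0)) (fracPKernel α S t) :=
  ((isRapidWeight_wright h0 h1).const_mul_id_mul h0.le).stronglyIntegrable S
    (Real.rpow_nonneg ht α)

theorem continuous_fracP {α : ℝ} (h0 : 0 < α) (h1 : α ≤ 1) (x : H) :
    Continuous fun t : ℝ => fracP α S (max t 0) x := by
  rcases h1.eq_or_lt with h | h
  · simp only [fracP, if_pos h]
    exact S.continuous_orbit x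
  · simp only [fracP, if_neg h.ne]
    have h2 := ((isRapidWeight_wright h0 h).const_mul_id_mul h0.le).continuous_integral S
      (f := fun t => (max t 0) ^ α)
      ((continuous_id.max continuous_const).rpow_const fun _ => Or.inr h0.le)
      (fun t => Real.rpow_nonneg (le_max_right _ _) α) x
    refine h2.congr fun t => ?_
    rw [strongIntegral_apply _ _ (stronglyIntegrable_fracPKernel S h0 h (le_max_right _ _))]
    rfl

end FractionalFamilies

/-! ### Strong measurability of weakly continuous functions -/

section WeakMeasurability

variable {U : Type*} [NormedAddCommGroup U] [InnerProductSpace ℝ U]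

theorem continuous_starProjection_of_weak {X : Type*} [TopologicalSpace X] {f : X → U}
    (hf : ∀ u, Continuous fun s => inner ℝ u (f s)) (V : Submodule ℝ U) [FiniteDimensional ℝ V] :
    Continuous fun s => V.starProjection (f s) := by
  have h : ∀ s, V.starProjection (f s) =
      ∑ i, inner ℝ (stdOrthonormalBasis ℝ V i : U) (f s) • (stdOrthonormalBasis ℝ V i : U) := by
    intro s
    rw [Submodule.starProjection_apply,
      (stdOrthonormalBasis ℝ V).orthogonalProjectionOnto_apply_eq_sum]
    simp
  simp_rw [h]
  exact continuous_finsetSum _ fun i _ => (hf _).smul continuous_const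

/-- A weakly continuous function on a separable space is strongly measurable. -/
theorem stronglyMeasurable_of_weak_continuous [CompleteSpace U] {X : Type*} [TopologicalSpace X]
    [TopologicalSpace.SeparableSpace X] [Nonempty X] [MeasurableSpace X] [OpensMeasurableSpace X]
    [SecondCountableTopology X] [TopologicalSpace.PseudoMetrizableSpace X] {f : X → U}
    (hf : ∀ u, Continuous fun s => inner ℝ u (f s)) : StronglyMeasurable f := by
  let q := TopologicalSpace.denseSeq X
  let V : ℕ → Submodule ℝ U := fun n => Submodule.span ℝ (f ∘ q '' Set.Iio n)
  have hfin : ∀ n, FiniteDimensional ℝ (V n) := fun n =>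
    FiniteDimensional.span_of_finite ℝ ((Set.finite_Iio n).image _)
  have hmono : Monotone V := fun m n hmn =>
    Submodule.span_mono (Set.image_mono (Set.Iio_subset_Iio hmn))
  -- No separability of `U` is needed: a vector orthogonal to `f` on a dense sequence is orthogonal
  -- to all of `f` by weak continuity, so `f` lives in the closed span of countably many values.
  have hmem : ∀ s, f s ∈ (⨆ n, V n).topologicalClosure := by
    intro s
    rw [← Submodule.orthogonal_orthogonal_eq_closure, Submodule.mem_orthogonal]
    intro v hv
    have hq : ∀ n, inner ℝ v (f (q n)) = 0 := fun n => by
      rw [Submodule.mem_orthogonal'] at hv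
      exact hv _ (Submodule.mem_iSup_of_mem (n + 1) (Submodule.subset_span ⟨n, by simp, rfl⟩))
    have := Continuous.ext_on (TopologicalSpace.denseRange_denseSeq X) (hf v)
      (continuous_const (y := (0 : ℝ))) (by rintro _ ⟨n, rfl⟩; exact hq n)
    exact congrFun this s
  refine stronglyMeasurable_of_tendsto (u := atTop)
    (f := fun n s => (V n).starProjection (f s))
    (fun n => (continuous_starProjection_of_weak hf (V n)).stronglyMeasurable)
    (tendsto_pi_nhds.2 fun s => ?_)
  have h := Submodule.starProjection_tendsto_closure_iSup V hmono (f s)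
  rwa [Submodule.starProjection_eq_self_iff.2 (hmem s)] at h

end WeakMeasurability

/-! ### Strongly continuous operator families -/

section StronglyContinuous

variable {H U : Type*} [NormedAddCommGroup H] [InnerProductSpace ℝ H] [CompleteSpace H]
  [NormedAddCommGroup U] [InnerProductSpace ℝ U] [CompleteSpace U]
  {Q : ℝ → U →L[ℝ] H}

theorem exists_norm_le_of_strongly_continuous (hQ : ∀ u, Continuous fun s => Q s u) (a c : ℝ) :
    ∃ C : ℝ, ∀ s ∈ Set.Icc a c, ‖Q s‖ ≤ C := by
  obtain ⟨C, hC⟩ := banach_steinhaus (g := fun s : Set.Icc a c => Q s) fun u => by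
    obtain ⟨C, hC⟩ := isCompact_Icc.exists_bound_of_continuousOn
      (hQ u).continuousOn (s := Set.Icc a c)
    exact ⟨C, fun s => hC s s.2⟩
  exact ⟨C, fun s hs => hC ⟨s, hs⟩⟩

/-- Local uniform boundedness upgrades strong continuity to joint continuity, which makes `s ↦ Q s
(u s)` measurable for an `L²` control `u`. -/
theorem continuous_apply_of_strongly_continuous (hQ : ∀ u, Continuous fun s => Q s u) :
    Continuous fun p : ℝ × U => Q p.1 p.2 := by
  rw [continuous_iff_continuousAt]
  rintro ⟨s, u⟩
  obtain ⟨C, hC⟩ := exists_norm_le_of_strongly_continuous hQ (s - 1) (s + 1)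
  rw [ContinuousAt, tendsto_iff_norm_sub_tendsto_zero]
  have h1 : Tendsto (fun p : ℝ × U => C * ‖p.2 - u‖ + ‖Q p.1 u - Q s u‖) (𝓝 (s, u)) (𝓝 0) := by
    have : Continuous fun p : ℝ × U => C * ‖p.2 - u‖ + ‖Q p.1 u - Q s u‖ :=
      ((continuous_snd.sub continuous_const).norm.const_mul C).add
        (((hQ u).comp continuous_fst).sub continuous_const).norm
    simpa using this.tendsto (s, u)
  refine squeeze_zero' (Eventually.of_forall fun _ => norm_nonneg _) ?_ h1
  have h2 : ∀ᶠ p : ℝ × U in 𝓝 (s, u), p.1 ∈ Set.Icc (s - 1) (s + 1) :=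
    (continuous_fst.tendsto (s, u)).eventually
      (Icc_mem_nhds (show s - 1 < s by linarith) (show s < s + 1 by linarith))
  filter_upwards [h2] with p hp
  have h3 : Q p.1 p.2 - Q s u = Q p.1 (p.2 - u) + (Q p.1 u - Q s u) := by
    rw [map_sub]; abel
  rw [h3]
  exact (norm_add_le _ _).trans (by
    gcongr
    exact ((Q p.1).le_opNorm _).trans (by gcongr; exact hC _ hp))

/-- Adjoints of a strongly continuous family are in general only weakly continuous, which still
suffices for measurability. -/
theorem stronglyMeasurable_adjoint (hQ : ∀ u, Continuous fun s => Q s u) (φ : H) :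
    StronglyMeasurable fun s => ContinuousLinearMap.adjoint (Q s) φ := by
  refine stronglyMeasurable_of_weak_continuous fun u => ?_
  simp_rw [ContinuousLinearMap.adjoint_inner_right]
  exact (hQ u).inner continuous_const

end StronglyContinuous

/-! ### Weighted integral operators and their Gramians -/

section WeightedControl

variable {H U : Type*} [NormedAddCommGroup H] [InnerProductSpace ℝ H] [CompleteSpace H]
  [NormedAddCommGroup U] [InnerProductSpace ℝ U] [CompleteSpace U]

/-- A weight `k` and a strongly continuous family `Q` such that `k Q` has an `L²` norm bound on the
measurable set `I`. -/
structure IsControlKernel (μ : Measure ℝ) (I : Set ℝ) (k : ℝ → ℝ) (Q : ℝ → U →L[ℝ] H) : Prop where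
  measurableSet : MeasurableSet I
  measurable : Measurable k
  continuous : ∀ u, Continuous fun s => Q s u
  bound : ∃ m : ℝ → ℝ, MemLp m 2 (μ.restrict I) ∧ ∀ s ∈ I, ‖k s • Q s‖ ≤ m s

variable {μ : Measure ℝ} {I : Set ℝ} {k : ℝ → ℝ} {Q : ℝ → U →L[ℝ] H}

namespace IsControlKernel

/-- The integrand of the adjoint of `u ↦ ∫_I k Q u`. -/
noncomputable def adjFun (I : Set ℝ) (k : ℝ → ℝ) (Q : ℝ → U →L[ℝ] H) (φ : H) : ℝ → U :=
  I.indicator fun s => k s • ContinuousLinearMap.adjoint (Q s) φ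

theorem exists_bound (h : IsControlKernel μ I k Q) :
    ∃ m : ℝ → ℝ, MemLp m 2 μ ∧ ∀ φ s, ‖adjFun I k Q φ s‖ ≤ ‖φ‖ * ‖m s‖ := by
  obtain ⟨m, hm, hb⟩ := h.bound
  refine ⟨I.indicator m, (memLp_indicator_iff_restrict h.measurableSet).2 hm, fun φ s => ?_⟩
  by_cases hs : s ∈ I
  · rw [adjFun, Set.indicator_of_mem hs, Set.indicator_of_mem hs]
    have h1 : k s • ContinuousLinearMap.adjoint (Q s) φ =
        ContinuousLinearMap.adjoint (k s • Q s) φ := by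
      rw [map_smulₛₗ]; rfl
    rw [h1, mul_comm]
    refine (ContinuousLinearMap.le_opNorm _ _).trans ?_
    rw [LinearIsometryEquiv.norm_map]
    gcongr
    exact (hb s hs).trans (le_abs_self _)
  · rw [adjFun, Set.indicator_of_notMem hs, norm_zero]
    positivity

theorem memLp_adjFun (h : IsControlKernel μ I k Q) (φ : H) : MemLp (adjFun I k Q φ) 2 μ := by
  obtain ⟨m, hm, hb⟩ := h.exists_bound
  refine (hm.norm.const_mul ‖φ‖).mono' ?_ (Eventually.of_forall (hb φ))
  exact ((h.measurable.stronglyMeasurable.smul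
    (stronglyMeasurable_adjoint h.continuous φ)).indicator h.measurableSet).aestronglyMeasurable

/-- The bounded operator `φ ↦ 1_I k Q* φ` into `L²`. -/
noncomputable def adjOp (h : IsControlKernel μ I k Q) : H →L[ℝ] Lp U 2 μ :=
  LinearMap.mkContinuousOfExistsBound
    { toFun := fun φ => (h.memLp_adjFun φ).toLp (adjFun I k Q φ)
      map_add' := fun φ ψ => by
        rw [← MemLp.toLp_add]
        congr 1
        funext s
        by_cases hs : s ∈ I <;> simp [adjFun, hs]
      map_smul' := fun r φ => by
        rw [RingHom.id_apply, ← MemLp.toLp_const_smul]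
        congr 1
        funext s
        by_cases hs : s ∈ I <;> simp [adjFun, hs, smul_comm r] }
    (by
      obtain ⟨m, hm, hb⟩ := h.exists_bound
      refine ⟨‖hm.toLp m‖, fun φ => ?_⟩
      rw [mul_comm]
      refine Lp.norm_le_mul_norm_of_ae_le_mul ?_
      filter_upwards [(h.memLp_adjFun φ).coeFn_toLp, hm.coeFn_toLp] with s h1 h2
      simp only [LinearMap.coe_mk, AddHom.coe_mk]
      rw [h1, h2]
      exact hb φ s)

theorem coeFn_adjOp (h : IsControlKernel μ I k Q) (φ : H) : h.adjOp φ =ᵐ[μ] adjFun I k Q φ :=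
  (h.memLp_adjFun φ).coeFn_toLp

theorem integrable (h : IsControlKernel μ I k Q) (u : Lp U 2 μ) :
    Integrable (fun s => k s • Q s (u s)) (μ.restrict I) := by
  obtain ⟨m, hm, hb⟩ := h.bound
  have hu : MemLp (fun s => ‖u s‖) 2 (μ.restrict I) := (Lp.memLp u).norm.restrict I
  refine Integrable.mono' (hm.integrable_mul hu) ?_ ?_
  · have h1 : AEStronglyMeasurable (fun s => (s, u s)) (μ.restrict I) :=
      aestronglyMeasurable_id.prodMk (Lp.aestronglyMeasurable u).restrict
    exact h.measurable.aestronglyMeasurable.smul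
      ((continuous_apply_of_strongly_continuous h.continuous).comp_aestronglyMeasurable h1)
  · filter_upwards [ae_restrict_mem h.measurableSet] with s hs
    exact ((k s • Q s).le_opNorm (u s)).trans
      (mul_le_mul_of_nonneg_right (hb s hs) (norm_nonneg _))

theorem adjoint_adjOp (h : IsControlKernel μ I k Q) (u : Lp U 2 μ) :
    ContinuousLinearMap.adjoint h.adjOp u = ∫ s in I, k s • Q s (u s) ∂μ := by
  refine ext_inner_right ℝ fun φ => ?_
  rw [ContinuousLinearMap.adjoint_inner_left, L2.inner_def, real_inner_comm,
    ← integral_inner (h.integrable u), ← integral_indicator h.measurableSet]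
  refine integral_congr_ae ?_
  filter_upwards [h.coeFn_adjOp φ] with s hs
  rw [hs, adjFun]
  by_cases hsI : s ∈ I
  · rw [Set.indicator_of_mem hsI, Set.indicator_of_mem hsI, inner_smul_right, inner_smul_right,
      ContinuousLinearMap.adjoint_inner_right, real_inner_comm]
  · rw [Set.indicator_of_notMem hsI, Set.indicator_of_notMem hsI, inner_zero_right]

/-- Feeding in the control `1_I k Q* φ` turns the control integral into the Gramian, so
integrability of the Gramian kernel needs no separate estimate. -/
theorem adjoint_adjOp_adjOp (h : IsControlKernel μ I k Q) (φ : H) :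
    Integrable (fun s => k s • Q s (k s • ContinuousLinearMap.adjoint (Q s) φ)) (μ.restrict I) ∧
    ContinuousLinearMap.adjoint h.adjOp (h.adjOp φ) =
      ∫ s in I, k s • Q s (k s • ContinuousLinearMap.adjoint (Q s) φ) ∂μ := by
  have h1 : (fun s => k s • Q s (h.adjOp φ s)) =ᵐ[μ.restrict I]
      fun s => k s • Q s (k s • ContinuousLinearMap.adjoint (Q s) φ) := by
    filter_upwards [ae_restrict_of_ae (h.coeFn_adjOp φ), ae_restrict_mem h.measurableSet] with s hs hI
    rw [hs, adjFun, Set.indicator_of_mem hI]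
  exact ⟨(h.integrable _).congr h1, by rw [h.adjoint_adjOp, integral_congr_ae h1]⟩

theorem adjoint_adjOp_comp_of_disjoint {J : Set ℝ} {l : ℝ → ℝ} {R : ℝ → U →L[ℝ] H}
    (h : IsControlKernel μ I k Q) (h' : IsControlKernel μ J l R) (hd : Disjoint I J) :
    ContinuousLinearMap.adjoint h.adjOp ∘L h'.adjOp = 0 := by
  ext φ
  rw [ContinuousLinearMap.comp_apply, h.adjoint_adjOp, zero_apply]
  refine integral_eq_zero_of_ae ?_
  filter_upwards [ae_restrict_of_ae (h'.coeFn_adjOp φ), ae_restrict_mem h.measurableSet] with s hs hI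
  rw [hs, adjFun, Set.indicator_of_notMem (Set.disjoint_left.1 hd hI)]
  simp

end IsControlKernel

end WeightedControl

/-! ### Density of range and regularized inverses of `M M*` -/

section GramianCriterion

variable {X H : Type*} [NormedAddCommGroup X] [InnerProductSpace ℝ X] [CompleteSpace X]
  [NormedAddCommGroup H] [InnerProductSpace ℝ H] [CompleteSpace H] {M : X →L[ℝ] H} {G : H →L[ℝ] H}

theorem inner_gram (hG : M ∘L ContinuousLinearMap.adjoint M = G) (x : H) :
    inner ℝ (G x) x = ‖ContinuousLinearMap.adjoint M x‖ ^ 2 := by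
  rw [← hG, ContinuousLinearMap.comp_apply, ← ContinuousLinearMap.adjoint_inner_right,
    real_inner_self_eq_norm_sq]

theorem mul_norm_sq_le_inner_gram (hG : M ∘L ContinuousLinearMap.adjoint M = G) (ε : ℝ) (x : H) :
    ε * ‖x‖ ^ 2 ≤ inner ℝ ((ε • (1 : H →L[ℝ] H) + G) x) x := by
  have h : inner ℝ ((ε • (1 : H →L[ℝ] H) + G) x) x = ε * ‖x‖ ^ 2 + inner ℝ (G x) x := by
    simp [inner_add_left, inner_smul_left]
  rw [h, inner_gram hG]
  linarith [sq_nonneg ‖ContinuousLinearMap.adjoint M x‖]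

theorem isUnit_add_gram (hG : M ∘L ContinuousLinearMap.adjoint M = G) {ε : ℝ} (hε : 0 < ε) :
    IsUnit (ε • (1 : H →L[ℝ] H) + G) := by
  refine ContinuousLinearMap.isUnit_of_forall_le_norm_inner_map _ (c := ⟨ε, hε.le⟩) hε fun x => ?_
  rw [mul_comm]
  exact (mul_norm_sq_le_inner_gram hG ε x).trans (Real.le_norm_self _)

/-- The regularized inverse `ε (ε I + G)⁻¹`. -/
noncomputable def regInverse (G : H →L[ℝ] H) (ε : ℝ) : H →L[ℝ] H :=
  ε • Ring.inverse (ε • (1 : H →L[ℝ] H) + G)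

theorem add_gram_regInverse (hG : M ∘L ContinuousLinearMap.adjoint M = G) {ε : ℝ} (hε : 0 < ε)
    (h : H) : (ε • (1 : H →L[ℝ] H) + G) (regInverse G ε h) = ε • h := by
  have h1 := Ring.mul_inverse_cancel _ (isUnit_add_gram hG hε)
  have h2 := congrArg (fun T : H →L[ℝ] H => T h) h1
  simp only [mul_apply_eq_comp, one_apply_eq_self] at h2
  rw [regInverse, smul_apply, map_smul, h2]

theorem regInverse_add_gram (hG : M ∘L ContinuousLinearMap.adjoint M = G) {ε : ℝ} (hε : 0 < ε)
    (h : H) : regInverse G ε ((ε • (1 : H →L[ℝ] H) + G) h) = ε • h := by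
  have h1 := Ring.inverse_mul_cancel _ (isUnit_add_gram hG hε)
  have h2 := congrArg (fun T : H →L[ℝ] H => T h) h1
  simp only [mul_apply_eq_comp, one_apply_eq_self] at h2
  rw [regInverse, smul_apply, h2]

/-- Coercivity tested at `y = R_ε h` reads `ε ‖y‖² ≤ ε ⟪h, y⟫`; Cauchy–Schwarz does the rest. -/
theorem norm_regInverse_apply_le (hG : M ∘L ContinuousLinearMap.adjoint M = G) {ε : ℝ} (hε : 0 < ε)
    (h : H) : ‖regInverse G ε h‖ ≤ ‖h‖ := by
  have h1 := mul_norm_sq_le_inner_gram hG ε (regInverse G ε h)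
  rw [add_gram_regInverse hG hε, real_inner_smul_left] at h1
  have h2 := le_of_mul_le_mul_left h1 hε
  have h3 := real_inner_le_norm h (regInverse G ε h)
  by_contra! h4
  nlinarith [norm_nonneg h]

theorem tendsto_regInverse_of_injective (hG : M ∘L ContinuousLinearMap.adjoint M = G)
    (hinj : ∀ φ : H, G φ = 0 → φ = 0) (h : H) :
    Tendsto (fun ε : ℝ => regInverse G ε h) (𝓝[>] 0) (𝓝 0) := by
  have hself : ContinuousLinearMap.adjoint G = G := by
    rw [← hG, ContinuousLinearMap.adjoint_comp, ContinuousLinearMap.adjoint_adjoint]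
  have hdense : Dense (Set.range G) := by
    have h1 : (LinearMap.range (G : H →ₗ[ℝ] H))ᗮ = ⊥ := by
      rw [ContinuousLinearMap.orthogonal_range, hself, Submodule.eq_bot_iff]
      exact fun x hx => hinj x hx
    have h2 := Submodule.dense_iff_topologicalClosure_eq_top.2
      ((Submodule.topologicalClosure_eq_top_iff).2 h1)
    exact h2
  rw [Metric.tendsto_nhds]
  intro δ hδ
  obtain ⟨_, hz, ⟨z, rfl⟩⟩ := Metric.dense_iff.1 hdense h (δ / 2) (half_pos hδ)
  have hlim : Tendsto (fun ε : ℝ => ε * (2 * ‖z‖)) (𝓝[>] 0) (𝓝 0) := by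
    have : Continuous fun ε : ℝ => ε * (2 * ‖z‖) := by fun_prop
    simpa using (this.tendsto 0).mono_left nhdsWithin_le_nhds
  filter_upwards [self_mem_nhdsWithin, hlim.eventually_lt_const (half_pos hδ)] with ε hε hε2
  have hε : 0 < ε := hε
  -- `h` is approximated by `G z` in the dense range: the first term is small by contractivity, the
  -- second is at most `2 ε ‖z‖`.
  have e1 : regInverse G ε h = regInverse G ε (h - G z) + (ε • z - ε • regInverse G ε z) := by
    have := regInverse_add_gram hG hε z
    simp only [add_apply, smul_apply,
      one_apply_eq_self, map_add, map_smul] at this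
    rw [← this, map_sub]
    abel
  rw [dist_zero_right, e1]
  have n1 := norm_regInverse_apply_le hG hε (h - G z)
  have n2 := norm_regInverse_apply_le hG hε z
  have n3 : ‖ε • z - ε • regInverse G ε z‖ ≤ ε * (2 * ‖z‖) := by
    rw [← smul_sub, norm_smul, Real.norm_of_nonneg hε.le]
    refine mul_le_mul_of_nonneg_left ((norm_sub_le _ _).trans ?_) hε.le
    linarith
  rw [Metric.mem_ball, dist_comm, dist_eq_norm] at hz
  linarith [norm_add_le (regInverse G ε (h - G z)) (ε • z - ε • regInverse G ε z)]

theorem tfae_gram (hG : M ∘L ContinuousLinearMap.adjoint M = G) :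
    List.TFAE [
      closure (Set.range M) = Set.univ,
      ∀ φ : H, ContinuousLinearMap.adjoint M φ = 0 → φ = 0,
      IsStrictlyPos G,
      ∀ h : H, Tendsto (fun ε : ℝ => regInverse G ε h) (𝓝[>] 0) (𝓝 0),
      ∀ h g : H, Tendsto (fun ε : ℝ => inner ℝ (regInverse G ε h) g) (𝓝[>] 0) (𝓝 0)] := by
  tfae_have 1 ↔ 2 := by
    have h1 : closure (Set.range M) = Set.univ ↔
        (LinearMap.range (M : X →ₗ[ℝ] H))ᗮ = ⊥ := by
      rw [← Submodule.topologicalClosure_eq_top_iff,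
        ← Submodule.dense_iff_topologicalClosure_eq_top, dense_iff_closure_eq]
      rfl
    rw [h1, ContinuousLinearMap.orthogonal_range, Submodule.eq_bot_iff]
    rfl
  tfae_have 2 → 3 := by
    intro h y hy
    rw [inner_gram hG]
    have : 0 < ‖ContinuousLinearMap.adjoint M y‖ := norm_pos_iff.2 fun h0 => hy (h y h0)
    positivity
  tfae_have 3 → 4 := by
    intro h
    refine tendsto_regInverse_of_injective hG fun φ hφ => ?_
    by_contra hne
    have := h φ hne
    rw [hφ, inner_zero_left] at this
    exact lt_irrefl _ this
  tfae_have 4 → 5 := by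
    intro h x g
    simpa using (h x).inner (tendsto_const_nhds (x := g))
  tfae_have 5 → 2 := by
    intro h φ hφ
    have hGφ : G φ = 0 := by
      rw [← hG, ContinuousLinearMap.comp_apply, hφ, map_zero]
    -- On the kernel of `G` the regularized inverse is the identity, so the weak limit `0` equals
    -- `‖φ‖²`.
    have h1 : ∀ᶠ ε : ℝ in 𝓝[>] 0, inner ℝ (regInverse G ε φ) φ = inner ℝ φ φ := by
      filter_upwards [self_mem_nhdsWithin] with ε hε
      have hε : 0 < ε := hε
      have h2 := regInverse_add_gram hG hε φ
      simp only [add_apply, smul_apply,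
        one_apply_eq_self, hGφ, add_zero, map_smul] at h2
      rw [smul_right_injective H hε.ne' h2]
    have h3 := tendsto_nhds_unique ((tendsto_congr' h1).1 (h φ φ)) tendsto_const_nhds
    exact inner_self_eq_zero.1 h3.symm
  tfae_finish

variable {U ι : Type*} [NormedAddCommGroup U] [InnerProductSpace ℝ U] [CompleteSpace U] [Fintype ι]

theorem exists_productOp (A : X →L[ℝ] H) (C : ι → U →L[ℝ] H) :
    ∃ M : WithLp 2 (X × PiLp 2 (fun _ : ι => U)) →L[ℝ] H,
      (∀ w, M w = A w.fst + ∑ k, C k (w.snd k)) ∧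
      M ∘L ContinuousLinearMap.adjoint M =
        A ∘L ContinuousLinearMap.adjoint A + ∑ k, C k ∘L ContinuousLinearMap.adjoint (C k) := by
  let M : WithLp 2 (X × PiLp 2 (fun _ : ι => U)) →L[ℝ] H :=
    A ∘L WithLp.fstL 2 ℝ X (PiLp 2 (fun _ : ι => U)) +
      ∑ k, C k ∘L PiLp.proj 2 (fun _ : ι => U) k ∘L WithLp.sndL 2 ℝ X (PiLp 2 (fun _ : ι => U))
  have hM : ∀ w, M w = A w.fst + ∑ k, C k (w.snd k) := fun w => by
    simp [M]
  have hadj : ∀ φ, ContinuousLinearMap.adjoint M φ =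
      WithLp.toLp 2 (ContinuousLinearMap.adjoint A φ,
        WithLp.toLp 2 fun k => ContinuousLinearMap.adjoint (C k) φ) := fun φ => by
    refine ext_inner_right ℝ fun w => ?_
    rw [ContinuousLinearMap.adjoint_inner_left, hM, inner_add_right, inner_sum,
      WithLp.prod_inner_apply, PiLp.inner_apply]
    simp only [ContinuousLinearMap.adjoint_inner_left]
    rfl
  refine ⟨M, hM, ?_⟩
  ext φ
  rw [ContinuousLinearMap.comp_apply, hM, hadj]
  simp

end GramianCriterion

/-! ### The controllability map and Gramian of the impulsive system -/

namespace FracImpulsiveSystem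

variable {H U : Type*} [NormedAddCommGroup H] [InnerProductSpace ℝ H] [CompleteSpace H]
  [NormedAddCommGroup U] [InnerProductSpace ℝ U] [CompleteSpace U] (sys : FracImpulsiveSystem H U)

theorem memLp_rpow_sub {β a c : ℝ} (hβ : 1 / 2 < β) (hac : a ≤ c) :
    MemLp (fun s : ℝ => (c - s) ^ (β - 1)) 2 (volume.restrict (Set.Ioc a c)) := by
  rw [memLp_two_iff_integrable_sq
    (Measurable.aestronglyMeasurable (f := fun s : ℝ => (c - s) ^ (β - 1)) (by fun_prop))]
  have h := ((intervalIntegral.intervalIntegrable_rpow' (a := c - c) (b := c - a)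
    (r := 2 * β - 2) (by linarith)).comp_sub_left c).symm
  simp only [sub_sub_cancel] at h
  refine ((intervalIntegrable_iff_integrableOn_Ioc_of_le hac).1 h).congr ?_
  filter_upwards [ae_restrict_mem measurableSet_Ioc] with s hs
  rw [← Real.rpow_mul_natCast (sub_nonneg.2 hs.2)]
  congr 1
  push_cast
  ring

/-- Uniform boundedness on `[a, c]` controls the operator factor, and `α > 1/2` makes the scalar one
square integrable; for `B = 0` the bound is `0`. The truncation `max (c - s) 0` gives strong
continuity on all of `ℝ` and changes nothing on `(a, c]`. -/
theorem isControlKernel (hα : 1 / 2 < sys.α ∨ sys.B = 0) {a c : ℝ} (hac : a ≤ c) :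
    IsControlKernel (volume.restrict (Set.Icc 0 sys.b)) (Set.Ioc a c)
      (fun s => (c - s) ^ (sys.α - 1))
      (fun s => fracP sys.α sys.S (max (c - s) 0) ∘L sys.B) where
  measurableSet := measurableSet_Ioc
  measurable := by fun_prop
  continuous u := (continuous_fracP sys.S sys.α_pos sys.α_le_one (sys.B u)).comp
    (continuous_const.sub continuous_id)
  bound := by
    rcases hα with hα | hB
    · obtain ⟨C, hC⟩ := exists_norm_le_of_strongly_continuous
        (Q := fun s => fracP sys.α sys.S (max (c - s) 0) ∘L sys.B)
        (fun u => (continuous_fracP sys.S sys.α_pos sys.α_le_one (sys.B u)).comp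
          (continuous_const.sub continuous_id)) a c
      refine ⟨fun s => (c - s) ^ (sys.α - 1) * C, ?_, fun s hs => ?_⟩
      · refine ((memLp_rpow_sub hα hac).mul_const C).mono_measure ?_
        exact Measure.restrict_mono_measure Measure.restrict_le_self _
      · rw [norm_smul, Real.norm_of_nonneg (Real.rpow_nonneg (sub_nonneg.2 hs.2) _)]
        exact mul_le_mul_of_nonneg_left (hC s (Set.Ioc_subset_Icc_self hs))
          (Real.rpow_nonneg (sub_nonneg.2 hs.2) _)
    · exact ⟨0, MemLp.zero, fun s _ => by simp [hB]⟩

open Classical in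
/-- The adjoint of `u ↦ ∫_a^c (c - s)^{α-1} 𝒫_α(c - s) B u(s) ds` on `L²([0,b], U)`. -/
noncomputable def segAdj (a c : ℝ) : H →L[ℝ] Lp U 2 (volume.restrict (Set.Icc 0 sys.b)) :=
  if h : IsControlKernel (volume.restrict (Set.Icc 0 sys.b)) (Set.Ioc a c)
      (fun s => (c - s) ^ (sys.α - 1))
      (fun s => fracP sys.α sys.S (max (c - s) 0) ∘L sys.B) then h.adjOp else 0

variable {sys}

theorem segAdj_eq (hα : 1 / 2 < sys.α ∨ sys.B = 0) {a c : ℝ} (hac : a ≤ c) :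
    sys.segAdj a c = (sys.isControlKernel hα hac).adjOp :=
  dif_pos _

theorem restrict_restrict_segment {a c : ℝ} (ha : 0 ≤ a) (hc : c ≤ sys.b) :
    (volume.restrict (Set.Icc 0 sys.b)).restrict (Set.Ioc a c) =
      volume.restrict (Set.Ioc a c) := by
  rw [Measure.restrict_restrict measurableSet_Ioc, Set.inter_eq_left.2]
  exact fun s hs => ⟨ha.trans hs.1.le, hs.2.trans hc⟩

theorem segIntegrand_eqOn (a c : ℝ) (u : ℝ → U) : Set.EqOn
    (fun s => (c - s) ^ (sys.α - 1) • (fracP sys.α sys.S (max (c - s) 0) ∘L sys.B) (u s))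
    (sys.segIntegrand c u) (Set.Ioc a c) := by
  intro s hs
  simp only [segIntegrand, max_eq_left (sub_nonneg.2 hs.2), ContinuousLinearMap.comp_apply]

theorem gramKernel_eqOn (a c : ℝ) (φ : H) : Set.EqOn
    (fun s => (c - s) ^ (sys.α - 1) • (fracP sys.α sys.S (max (c - s) 0) ∘L sys.B)
      ((c - s) ^ (sys.α - 1) • ContinuousLinearMap.adjoint
        (fracP sys.α sys.S (max (c - s) 0) ∘L sys.B) φ))
    (fun s => sys.gramKernel c s φ) (Set.Ioc a c) := by
  intro s hs
  -- Valid also at the endpoint `s = c`, where only `c - s ≥ 0` is available.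
  have h : (c - s) ^ (2 * sys.α - 2) = (c - s) ^ (sys.α - 1) * (c - s) ^ (sys.α - 1) := by
    rw [← sq, ← Real.rpow_mul_natCast (sub_nonneg.2 hs.2)]
    congr 1
    push_cast
    ring
  simp only [gramKernel, max_eq_left (sub_nonneg.2 hs.2), ContinuousLinearMap.adjoint_comp,
    ContinuousLinearMap.comp_apply, smul_apply, map_smul, smul_smul, h]

theorem integrableOn_segIntegrand (hα : 1 / 2 < sys.α ∨ sys.B = 0) {a c : ℝ} (ha : 0 ≤ a)
    (hac : a ≤ c) (hc : c ≤ sys.b) (u : Lp U 2 (volume.restrict (Set.Icc 0 sys.b))) :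
    IntegrableOn (sys.segIntegrand c u) (Set.Ioc a c) := by
  have h := (sys.isControlKernel hα hac).integrable u
  rw [restrict_restrict_segment ha hc] at h
  exact IntegrableOn.congr_fun h (segIntegrand_eqOn a c u) measurableSet_Ioc

theorem adjoint_segAdj (hα : 1 / 2 < sys.α ∨ sys.B = 0) {a c : ℝ} (ha : 0 ≤ a)
    (hac : a ≤ c) (hc : c ≤ sys.b) (u : Lp U 2 (volume.restrict (Set.Icc 0 sys.b))) :
    ContinuousLinearMap.adjoint (sys.segAdj a c) u = sys.segMap a c u := by
  rw [segAdj_eq hα hac, IsControlKernel.adjoint_adjOp, restrict_restrict_segment ha hc]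
  exact setIntegral_congr_fun measurableSet_Ioc (segIntegrand_eqOn a c u)

theorem stronglyIntegrable_gramKernel (hα : 1 / 2 < sys.α ∨ sys.B = 0) {a c : ℝ} (ha : 0 ≤ a)
    (hac : a ≤ c) (hc : c ≤ sys.b) :
    StronglyIntegrable (volume.restrict (Set.Ioc a c)) (sys.gramKernel c) := by
  intro φ
  have h := ((sys.isControlKernel hα hac).adjoint_adjOp_adjOp φ).1
  rw [restrict_restrict_segment ha hc] at h
  exact IntegrableOn.congr_fun h (gramKernel_eqOn a c φ) measurableSet_Ioc

theorem adjoint_segAdj_comp_self (hα : 1 / 2 < sys.α ∨ sys.B = 0) {a c : ℝ} (ha : 0 ≤ a)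
    (hac : a ≤ c) (hc : c ≤ sys.b) :
    ContinuousLinearMap.adjoint (sys.segAdj a c) ∘L sys.segAdj a c = sys.segGram a c := by
  ext φ
  rw [ContinuousLinearMap.comp_apply, segAdj_eq hα hac,
    ((sys.isControlKernel hα hac).adjoint_adjOp_adjOp φ).2, restrict_restrict_segment ha hc,
    segGram, strongIntegral_apply _ _ (stronglyIntegrable_gramKernel hα ha hac hc)]
  exact setIntegral_congr_fun measurableSet_Ioc (gramKernel_eqOn a c φ)

theorem adjoint_segAdj_comp_of_disjoint (hα : 1 / 2 < sys.α ∨ sys.B = 0) {a c a' c' : ℝ}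
    (hac : a ≤ c) (hac' : a' ≤ c') (hd : Disjoint (Set.Ioc a c) (Set.Ioc a' c')) :
    ContinuousLinearMap.adjoint (sys.segAdj a c) ∘L sys.segAdj a' c' = 0 := by
  rw [segAdj_eq hα hac, segAdj_eq hα hac']
  exact IsControlKernel.adjoint_adjOp_comp_of_disjoint _ _ hd

theorem t_mono {i j : ℕ} (hij : i ≤ j) (hj : j ≤ sys.n) : sys.t i ≤ sys.t j :=
  sys.t_strictMonoOn.monotoneOn (Set.mem_Iic.2 (hij.trans hj)) (Set.mem_Iic.2 hj) hij

theorem t_nonneg {i : ℕ} (hi : i ≤ sys.n) : 0 ≤ sys.t i := by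
  rw [← sys.t_zero]
  exact t_mono (Nat.zero_le i) hi

theorem t_le_b {i : ℕ} (hi : i ≤ sys.n) : sys.t i ≤ sys.b := (t_mono hi le_rfl).trans sys.t_le

theorem converges (hα : 1 / 2 < sys.α ∨ sys.B = 0) : sys.Converges where
  wright h θ := (hasSum_wrightTerm sys.α_pos h θ).summable
  fracS h t ht := stronglyIntegrable_fracSKernel sys.S sys.α_pos h ht
  fracP h t ht := stronglyIntegrable_fracPKernel sys.S sys.α_pos h ht
  seg u i hi := by
    rw [Finset.mem_Icc] at hi
    exact integrableOn_segIntegrand hα (t_nonneg (by omega)) (t_mono (by omega) hi.2)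
      (t_le_b hi.2) u
  seg_last u := integrableOn_segIntegrand hα (t_nonneg le_rfl) sys.t_le le_rfl u
  gram i hi := by
    rw [Finset.mem_Icc] at hi
    exact stronglyIntegrable_gramKernel hα (t_nonneg (by omega)) (t_mono (by omega) hi.2)
      (t_le_b hi.2)
  gram_last := stronglyIntegrable_gramKernel hα (t_nonneg le_rfl) sys.t_le le_rfl

theorem propagator_last : sys.propagator (sys.n + 1) =
    fracS sys.α sys.S (sys.b - sys.t sys.n) := by
  simp [propagator]

theorem sum_impulse_gram :
    ∑ k : Finset.Icc 1 sys.n, (sys.propagator (k + 1) ∘L sys.E k) ∘L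
      ContinuousLinearMap.adjoint (sys.propagator (k + 1) ∘L sys.E k) =
    sys.gramΩt + sys.gramΨt := by
  have h1 : ∀ k : ℕ, (sys.propagator (k + 1) ∘L sys.E k) ∘L
      ContinuousLinearMap.adjoint (sys.propagator (k + 1) ∘L sys.E k) =
      sys.propagator (k + 1) ∘L sys.E k ∘L ContinuousLinearMap.adjoint (sys.E k) ∘L
      ContinuousLinearMap.adjoint (sys.propagator (k + 1)) := fun k => by
    rw [ContinuousLinearMap.adjoint_comp]
    rfl
  rw [Finset.sum_coe_sort (Finset.Icc 1 sys.n) fun k =>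
    (sys.propagator (k + 1) ∘L sys.E k) ∘L
      ContinuousLinearMap.adjoint (sys.propagator (k + 1) ∘L sys.E k)]
  simp_rw [h1]
  by_cases hn : sys.n = 0
  · simp [gramΩt, gramΨt, hn]
  -- The top term `k = n` is `Ω̃`, as `W_{n+1} = 𝒮_α(b - t_n)`; the shift `i = k + 1` turns the
  -- others into `Ψ̃`.
  · obtain ⟨m, hm⟩ := Nat.exists_eq_succ_of_ne_zero hn
    have h2 : Finset.Icc 2 sys.n = (Finset.Icc 1 m).map (addRightEmbedding 1) := by
      rw [Finset.map_add_right_Icc, hm]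
    rw [gramΩt, if_neg hn, gramΨt, h2, Finset.sum_map, ← propagator_last]
    have h3 : Finset.Icc 1 sys.n = Finset.Icc 1 (m + 1) := by rw [hm]
    rw [h3, Finset.sum_Icc_succ_top (by omega), add_comm]
    congr 1
    rw [hm]

/-- The adjoint of the part of the controllability map that acts on the distributed control. -/
noncomputable def distributedAdj (sys : FracImpulsiveSystem H U) :
    H →L[ℝ] Lp U 2 (volume.restrict (Set.Icc 0 sys.b)) :=
  sys.segAdj (sys.t sys.n) sys.b + ∑ i ∈ Finset.Icc 1 sys.n,
    sys.segAdj (sys.t (i - 1)) (sys.t i) ∘L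
      ContinuousLinearMap.adjoint (sys.propagator (i + 1) * (1 + sys.D i))

theorem adjoint_distributedAdj : ContinuousLinearMap.adjoint sys.distributedAdj =
    ContinuousLinearMap.adjoint (sys.segAdj (sys.t sys.n) sys.b) + ∑ i ∈ Finset.Icc 1 sys.n,
      (sys.propagator (i + 1) * (1 + sys.D i)) ∘L
        ContinuousLinearMap.adjoint (sys.segAdj (sys.t (i - 1)) (sys.t i)) := by
  rw [distributedAdj, map_add, map_sum]
  simp only [ContinuousLinearMap.adjoint_comp, ContinuousLinearMap.adjoint_adjoint]

theorem disjoint_segments {i j : ℕ} (hi : 1 ≤ i) (hj : j ≤ sys.n) (hij : i < j) :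
    Disjoint (Set.Ioc (sys.t (i - 1)) (sys.t i)) (Set.Ioc (sys.t (j - 1)) (sys.t j)) := by
  rw [Set.disjoint_left]
  intro s hs hs'
  have := t_mono (sys := sys) (i := i) (j := j - 1) (by omega) (by omega)
  linarith [hs.2, hs'.1]

theorem disjoint_segments_last {i : ℕ} (hi : i ≤ sys.n) :
    Disjoint (Set.Ioc (sys.t (i - 1)) (sys.t i)) (Set.Ioc (sys.t sys.n) sys.b) := by
  rw [Set.disjoint_left]
  intro s hs hs'
  have := t_mono (sys := sys) hi le_rfl
  linarith [hs.2, hs'.1]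

theorem adjoint_distributedAdj_apply (hα : 1 / 2 < sys.α ∨ sys.B = 0)
    (u : Lp U 2 (volume.restrict (Set.Icc 0 sys.b))) :
    ContinuousLinearMap.adjoint sys.distributedAdj u = sys.segMap (sys.t sys.n) sys.b u +
      ∑ i ∈ Finset.Icc 1 sys.n,
        sys.propagator (i + 1) ((1 + sys.D i) (sys.segMap (sys.t (i - 1)) (sys.t i) u)) := by
  rw [adjoint_distributedAdj, add_apply, sum_apply,
    adjoint_segAdj hα (t_nonneg le_rfl) sys.t_le le_rfl]
  congr 1
  refine Finset.sum_congr rfl fun i hi => ?_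
  rw [Finset.mem_Icc] at hi
  rw [ContinuousLinearMap.comp_apply, adjoint_segAdj hα (t_nonneg (by omega))
    (t_mono (by omega) hi.2) (t_le_b hi.2)]
  rfl

theorem distributed_gram (hα : 1 / 2 < sys.α ∨ sys.B = 0) :
    ContinuousLinearMap.adjoint sys.distributedAdj ∘L sys.distributedAdj =
      sys.gramΩ + sys.gramΨ := by
  have hle : ∀ i ∈ Finset.Icc 1 sys.n, sys.t (i - 1) ≤ sys.t i := fun i hi =>
    t_mono (by omega) (Finset.mem_Icc.1 hi).2
  rw [adjoint_distributedAdj, ContinuousLinearMap.add_comp, distributedAdj,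
    ContinuousLinearMap.comp_add, gramΩ, gramΨ,
    adjoint_segAdj_comp_self hα (t_nonneg le_rfl) sys.t_le le_rfl, ContinuousLinearMap.comp_finsetSum,
    ContinuousLinearMap.finsetSum_comp, add_assoc]
  congr 1
  -- The products of the last interval with the earlier ones vanish by disjointness; among the
  -- earlier ones only the diagonal `j = i` survives.
  rw [Finset.sum_eq_zero, zero_add]
  · refine Finset.sum_congr rfl fun i hi => ?_
    have hi' := Finset.mem_Icc.1 hi
    rw [ContinuousLinearMap.comp_assoc, ContinuousLinearMap.comp_add,
      adjoint_segAdj_comp_of_disjoint hα (hle i hi) sys.t_le (disjoint_segments_last hi'.2),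
      zero_add, ContinuousLinearMap.comp_finsetSum, Finset.sum_eq_single i]
    · rw [← ContinuousLinearMap.comp_assoc (ContinuousLinearMap.adjoint (sys.segAdj _ _)),
        adjoint_segAdj_comp_self hα (t_nonneg (by omega)) (hle i hi) (t_le_b hi'.2)]
      rfl
    · intro j hj hji
      have hj' := Finset.mem_Icc.1 hj
      have hd : Disjoint (Set.Ioc (sys.t (i - 1)) (sys.t i))
          (Set.Ioc (sys.t (j - 1)) (sys.t j)) := by
        rcases lt_or_gt_of_ne hji with h | h
        · exact (disjoint_segments hj'.1 hi'.2 h).symm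
        · exact disjoint_segments hi'.1 hj'.2 h
      rw [← ContinuousLinearMap.comp_assoc,
        adjoint_segAdj_comp_of_disjoint hα (hle i hi) (hle j hj) hd, ContinuousLinearMap.zero_comp]
    · exact fun h => absurd hi h
  · intro i hi
    rw [← ContinuousLinearMap.comp_assoc, adjoint_segAdj_comp_of_disjoint hα sys.t_le (hle i hi)
      (disjoint_segments_last (Finset.mem_Icc.1 hi).2).symm, ContinuousLinearMap.zero_comp]

end FracImpulsiveSystem

theorem mainTheorem1 {H U : Type*}
    [NormedAddCommGroup H] [InnerProductSpace ℝ H] [CompleteSpace H]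
    [NormedAddCommGroup U] [InnerProductSpace ℝ U] [CompleteSpace U]
    (sys : FracImpulsiveSystem H U) (hα : 1 / 2 < sys.α ∨ sys.B = 0) :
    sys.Converges ∧
    ∃ M : sys.Controls →L[ℝ] H,
      (∀ w, M w = sys.controlMap w) ∧
      M ∘L ContinuousLinearMap.adjoint M = sys.gramian ∧
      (∀ ε : ℝ, 0 < ε → IsUnit (ε • (1 : H →L[ℝ] H) + sys.gramian)) ∧
      List.TFAE [
        sys.IsApproxControllable,
        ∀ φ : H, ContinuousLinearMap.adjoint M φ = 0 → φ = 0,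
        IsStrictlyPos sys.gramian,
        ∀ h : H, Tendsto (fun ε : ℝ => sys.resolvent ε h) (𝓝[>] 0) (𝓝 0),
        ∀ h g : H, Tendsto (fun ε : ℝ => inner ℝ (sys.resolvent ε h) g) (𝓝[>] 0) (𝓝 0)] := by
  refine ⟨FracImpulsiveSystem.converges hα, ?_⟩
  obtain ⟨M, hM, hMM⟩ := exists_productOp (ContinuousLinearMap.adjoint sys.distributedAdj)
    fun k : Finset.Icc 1 sys.n => sys.propagator (k + 1) ∘L sys.E k
  have hctrl : ∀ w, M w = sys.controlMap w := fun w => by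
    rw [hM, FracImpulsiveSystem.adjoint_distributedAdj_apply hα]
    rfl
  have hG : M ∘L ContinuousLinearMap.adjoint M = sys.gramian := by
    rw [hMM, ContinuousLinearMap.adjoint_adjoint, FracImpulsiveSystem.distributed_gram hα,
      FracImpulsiveSystem.sum_impulse_gram, FracImpulsiveSystem.gramian, add_assoc _ sys.gramΩt]
  refine ⟨M, hctrl, hG, fun ε hε => isUnit_add_gram hG hε, ?_⟩
  have h := tfae_gram hG
  rw [show (M : sys.Controls → H) = sys.controlMap from funext hctrl] at h
  -- `resolvent` and `IsApproxControllable` unfold to the forms in `tfae_gram`.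
  exact h
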